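/- **Definitions.** Let $k\in\{0,1,2,\dots\}\cup\{\infty\}$. *$\mathcal M$-spaces.* Let $\mathcal M$ be a set of functions $\mathbf R\to\mathbf R$. For a set $\mathcal C$ of curves $\mathbf R\to X$ put $\Phi\mathcal C=\{f:X\to\mathbf R \mid f\circ c\in\mathcal M\ \forall c\in\mathcal C\}$; for a set $\mathcal F$ of functions $X\to\mathbf R$ put $\Gamma\mathcal F=\{c:\mathbf R\to X\mid f\circ c\in\mathcal M\ \forall f\in\mathcal F\}$. An $\mathcal M$-structure on $X$ is a pair $(\mathcal C,\mathcal F)$ with $\Phi\mathcal C=\mathcal F$ and $\Gamma\mathcal F=\mathcal C$. The $\mathcal M$-structure generated by a set $\mathcal C_0$ of curves is the one with $\mathcal F=\Phi\mathcal C_0$, $\mathcal C=\Gamma\mathcal F$; it is the smallest one with $\mathcal C_0\subseteq\mathcal C$. The category $\underline{\mathcal M}$ has as objects the sets with an $\mathcal M$-structure, and as morphisms ($\mathcal M$-maps) the maps $h:X\to Y$ with $h\circ c\in\mathcal C_Y$ for all $c\in\mathcal C_X$. *$P\mathcal M$-diffeologies.* Let $P\mathcal M$ be a class of continuous maps $f:U\to\mathbf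 R^m$, $U\subseteq\mathbf R^n$ open, $n,m\ge 0$, which contains the constants, is closed under composition, and is such that a map $f:U\to\mathbf R$ that belongs to $P\mathcal M$ on a neighbourhood of each point of $U$ belongs to $P\mathcal M$. An $n$-plaque on $X$ is a map $p:U\to X$ with $U\subseteq\mathbf R^n$ open. A $P\mathcal M$-diffeology $P(X)$ on $X$ is a set of plaques whose images cover $X$, such that (i) if a set of $n$-plaques in $P(X)$ has a common extension, then the smallest common extension is in $P(X)$; (ii) if $p:U\to X$ is in $P(X)$ and $\phi:U'\to U$ is in $P\mathcal M$, then $p\circ\phi\in P(X)$. The standard diffeology of $\mathbf R$ consists of the real valued members of $P\mathcal M$. The category $\underline{P\mathcal M}$ has as objects the sets with a $P\mathcal M$-diffeology, and as morphisms the set $D(X,Y)$ of maps $f:X\to Y$ with $f\circ p\in P(Y)$ for all $p\in P(X)$; $D(X)=D(X,\mathbf R)$. Two diffeologies on $X$ are equivalent ($\sim$) if they have the same $D(X)$. $P_1(X)$ denotes the set of the $1$-plaques in $P(X)$ with domain $\mathbf R$. For a set $\mathcal F$ of functions $X\to\mathbf R$, the diffeology of all plaques $p$ with $f\circ p\in P\mathcal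 M$ for all $f\in\mathcal F$ is also denoted $\Gamma\mathcal F$; $P(X)$ is called maximal if $\Gamma D(X)=P(X)$. $\underline{P\mathcal M}_1$ is the category whose objects are the spaces with a maximal diffeology, and whose morphisms $X\to Y$ are the maps $f$ such that $g\in D(Y)$ implies $g\circ f\in D(X)$. The category of all $P\mathcal M$-diffeological spaces with this second kind of morphism is denoted $\underline{P\mathcal M}_1'$. *$Lip^k$.* $P\mathcal M_L^k$ is the class of the $C^k$ maps $f:U\to\mathbf R^m$, $U\subseteq\mathbf R^n$ open, all of whose derivatives of (finite) order $j$, $0\le j\le k$, are locally Lipschitz; $Lip^k(\mathbf R,\mathbf R)$ is the set of such functions $\mathbf R\to\mathbf R$. **Proposition 5.2.** Let $P\mathcal M=P\mathcal M_L^k$ and $\mathcal M=Lip^k(\mathbf R,\mathbf R)$. (a) For every $\mathcal M$-structure $(\mathcal C,\mathcal F)$ on a set $X$, the $P\mathcal M$-diffeology $P(X)=\Gamma\mathcal F$ satisfies $P_1(X)=\mathcal C$ and $D(X)=\mathcal F$. This defines (with the identity on maps) a functor $\Psi:\underline{\mathcal M}\to\underline{P\mathcal M}$, which is injective on objects, full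 and faithful. (b) For every $P\mathcal M$-diffeology $P(X)$ on a set $X$, the $\mathcal M$-structure $(\mathcal C,\mathcal F)$ generated by $\mathcal C_0=P_1(X)$ satisfies $\mathcal F=D(X)$. This defines (with the identity on maps) a functor $\Upsilon:\underline{P\mathcal M}\to\underline{\mathcal M}$, which is faithful and surjective on objects, and satisfies $\Upsilon\circ\Psi=\mathrm{Id}$ and $\Psi\circ\Upsilon(X,P(X))\sim(X,P(X))$. (c) $\Psi$ (as the identity on underlying sets and maps) induces equivalences of categories $\underline{\mathcal M}\simeq\underline{P\mathcal M}_1$ and $\underline{\mathcal M}\simeq\underline{P\mathcal M}_1'$. The same holds for every class $P\mathcal M$ as above, with $\mathcal M$ the set of the functions $\mathbf R\to\mathbf R$ in $P\mathcal M$, that satisfies the condition: for all $m$, all open $U\subseteq\mathbf R^m$ and all $h:U\to\mathbf R$, $h\in P\mathcal M$ if and only if $h\circ\gamma\in\mathcal M$ for all $\gamma:\mathbf R\to U$ in $P\mathcal M$. -/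

import Mathlib

open CategoryTheory TopologicalSpace Topology

universe u

/-! ## `M`-structures, for an arbitrary set `M` of functions `S → R` -/

section MStructures

variable {S R : Type}

/-- `Φ C`: the functions on `X` whose composites with all curves in `C` lie in `M`. -/
def functionsOf (M : Set (S → R)) {X : Type u} (C : Set (S → X)) : Set (X → R) :=
  {f | ∀ c ∈ C, f ∘ c ∈ M}

/-- `Γ F`: the curves in `X` whose composites with all functions in `F` lie in `M`. -/
def curvesOf (M : Set (S → R)) {X : Type u} (F : Set (X → R)) : Set (S → X) :=
  {c | ∀ f ∈ F, f ∘ c ∈ M}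

/-- An `M`-structure on `X`: curves and functions which determine each other. -/
@[ext]
structure MStructure (M : Set (S → R)) (X : Type u) where
  curves : Set (S → X)
  functions : Set (X → R)
  functionsOf_curves : functionsOf M curves = functions
  curvesOf_functions : curvesOf M functions = curves

/-- The `M`-structure generated by a set `C₀` of curves: `F = Φ C₀` and `C = Γ F`. -/
def MStructure.generate (M : Set (S → R)) {X : Type u} (C₀ : Set (S → X)) :
    MStructure M X where
  curves := curvesOf M (functionsOf M C₀)
  functions := functionsOf M C₀
  functionsOf_curves := by
    ext f
    exact ⟨fun h c hc => h c fun g hg => hg c hc, fun h c hc => hc f h⟩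
  curvesOf_functions := rfl

/-- `h : X → Y` is an `M`-map if it maps structure curves to structure curves. -/
def IsMMap {M : Set (S → R)} {X Y : Type u} (s : MStructure M X) (t : MStructure M Y)
    (h : X → Y) : Prop :=
  ∀ c ∈ s.curves, h ∘ c ∈ t.curves

/-- An `M`-space. -/
structure MSpace (M : Set (S → R)) : Type (u + 1) where
  carrier : Type u
  str : MStructure M carrier

/-- The category of `M`-spaces and `M`-maps. -/
instance (M : Set (S → R)) : Category (MSpace.{u} M) where
  Hom X Y := {h : X.carrier → Y.carrier // IsMMap X.str Y.str h}
  id X := ⟨id, fun _ hc => hc⟩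
  comp f g := ⟨g.1 ∘ f.1, fun c hc => g.2 _ (f.2 c hc)⟩

end MStructures

/-! ## Plaques -/

/-- An `n`-plaque on `X`: a map `U → X` with `U` open in `ℝⁿ`.  (Here `ℝⁿ` is `Fin n → ℝ`;
all notions below depend only on the equivalence class of the norm.) -/
structure Plaque (n : ℕ) (X : Type u) where
  dom : Opens (Fin n → ℝ)
  toFun : dom → X

/-- Plaques are ordered by extension: `p ≤ q` if `q` extends `p`. -/
instance (n : ℕ) (X : Type u) : PartialOrder (Plaque n X) where
  le p q := ∃ h : p.dom ≤ q.dom, ∀ x : p.dom, q.toFun ⟨x, h x.2⟩ = p.toFun x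
  le_refl p := ⟨le_rfl, fun _ => rfl⟩
  le_trans p q r := fun ⟨h, e⟩ ⟨h', e'⟩ =>
    ⟨h.trans h', fun x => (e' ⟨x, h x.2⟩).trans (e x)⟩
  le_antisymm p q := by
    rcases p with ⟨U, p⟩
    rcases q with ⟨V, q⟩
    rintro ⟨h, e⟩ ⟨h', -⟩
    obtain rfl : U = V := le_antisymm h h'
    congr 1
    exact funext fun x => (e x).symm

namespace Plaque

variable {n : ℕ} {X Y Z : Type u}

/-- The plaque `f ∘ p`. -/
def map {Y : Type*} (f : X → Y) (p : Plaque n X) : Plaque n Y := ⟨p.dom, f ∘ p.toFun⟩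

/-- The plaque `p ∘ φ`, for `φ : U' → U` where `U` is the domain of `p`. -/
def precomp {m : ℕ} (p : Plaque n X) (U' : Opens (Fin m → ℝ)) (φ : U' → p.dom) :
    Plaque m X := ⟨U', p.toFun ∘ φ⟩

/-- A curve `ℝ → X`, seen as a `1`-plaque with domain all of `ℝ¹`. -/
def ofCurve (c : ℝ → X) : Plaque 1 X := ⟨⊤, fun t => c (t.1 0)⟩

/-- The domain of the smallest common extension is covered by the domains of the members. -/
theorem exists_mem_of_isLUB {S : Set (Plaque n X)} {q : Plaque n X} (h : IsLUB S q)
    (x : q.dom) : ∃ p ∈ S, (x : Fin n → ℝ) ∈ p.dom := by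
  let W : Opens (Fin n → ℝ) := ⨆ p ∈ S, p.dom
  have hW : W ≤ q.dom := iSup₂_le fun p hp => (h.1 hp).1
  let r : Plaque n X := ⟨W, fun x => q.toFun ⟨x, hW x.2⟩⟩
  have hr : r ∈ upperBounds S := fun p hp =>
    ⟨le_iSup₂_of_le p hp le_rfl, fun x => (h.1 hp).2 x⟩
  have hx : (x : Fin n → ℝ) ∈ W := (h.2 hr).1 x.2
  simpa [W, Opens.mem_iSup] using hx

end Plaque

/-! ## Classes `PM` of maps between Euclidean open sets, and `PM`-diffeologies -/

/-- A class `PM` of continuous maps `f : U → ℝᵐ`, `U ⊆ ℝⁿ` open, which contains the constants, is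
closed under composition, and for which membership of a real valued map is local (so that the
real valued members form a diffeology on `ℝ`). -/
structure ParamClass where
  mem : ∀ {n m : ℕ} (U : Opens (Fin n → ℝ)), (U → (Fin m → ℝ)) → Prop
  continuous : ∀ {n m : ℕ} (U : Opens (Fin n → ℝ)) (f : U → (Fin m → ℝ)),
    mem U f → Continuous f
  const : ∀ {n m : ℕ} (U : Opens (Fin n → ℝ)) (y : Fin m → ℝ), mem U fun _ => y
  comp : ∀ {n m l : ℕ} (U : Opens (Fin n → ℝ)) (V : Opens (Fin m → ℝ)) (f : U → V)
    (g : V → (Fin l → ℝ)), mem U (fun x => (f x : Fin m → ℝ)) → mem V g → mem U (g ∘ f)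
  local_real : ∀ {n : ℕ} (U : Opens (Fin n → ℝ)) (f : U → (Fin 1 → ℝ)),
    (∀ x ∈ U, ∃ V : Opens (Fin n → ℝ), ∃ h : V ≤ U, x ∈ V ∧ mem V fun y => f ⟨y, h y.2⟩) →
      mem U f

namespace ParamClass

variable (PM : ParamClass)

/-- A real valued map on `U` belongs to `PM` (identifying `ℝ` with `ℝ¹`). -/
def memReal {n : ℕ} (U : Opens (Fin n → ℝ)) (f : U → ℝ) : Prop :=
  PM.mem U fun x (_ : Fin 1) => f x

/-- The members of `PM` which are functions `ℝ → ℝ`. -/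
def lineMaps : Set (ℝ → ℝ) :=
  {f | PM.memReal ⊤ fun t : (⊤ : Opens (Fin 1 → ℝ)) => f (t.1 0)}

/-- Detection by curves: a function `h : U → ℝ` on an open `U ⊆ ℝᵐ` belongs to `PM` if and only if
`h ∘ γ` belongs to `PM` for all curves `γ : ℝ → U` in `PM`. -/
def DetectedByCurves : Prop :=
  ∀ (m : ℕ) (U : Opens (Fin m → ℝ)) (h : U → ℝ),
    PM.memReal U h ↔
      ∀ γ : ℝ → U,
        PM.mem ⊤ (fun t : (⊤ : Opens (Fin 1 → ℝ)) => (γ (t.1 0) : Fin m → ℝ)) →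
          h ∘ γ ∈ PM.lineMaps

end ParamClass

/-- A `PM`-diffeology on `X`. -/
@[ext]
structure Diffeology (PM : ParamClass) (X : Type u) where
  plaques : ∀ n : ℕ, Set (Plaque n X)
  covers : ∀ x : X, ∃ n, ∃ p ∈ plaques n, x ∈ Set.range p.toFun
  /-- The smallest common extension of a set of plaques is a plaque. -/
  glue : ∀ (n : ℕ) (S : Set (Plaque n X)), S ⊆ plaques n → ∀ q, IsLUB S q → q ∈ plaques n
  comp : ∀ (m n : ℕ), ∀ p ∈ plaques n, ∀ (U' : Opens (Fin m → ℝ)) (φ : U' → p.dom),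
    PM.mem U' (fun x => (φ x : Fin n → ℝ)) → p.precomp U' φ ∈ plaques m

namespace Diffeology

variable {PM : ParamClass} {X Y : Type u}

theorem real_glue (PM : ParamClass) (n : ℕ) (S : Set (Plaque n ℝ))
    (hS : ∀ p ∈ S, PM.memReal p.dom p.toFun) (q : Plaque n ℝ) (hq : IsLUB S q) :
    PM.memReal q.dom q.toFun := by
  refine PM.local_real _ _ fun x hx => ?_
  obtain ⟨p, hp, hxp⟩ := Plaque.exists_mem_of_isLUB hq ⟨x, hx⟩
  refine ⟨p.dom, (hq.1 hp).1, hxp, ?_⟩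
  have h := hS p hp
  simp only [ParamClass.memReal, ← (hq.1 hp).2] at h
  exact h

/-- The standard `PM`-diffeology on `ℝ`. -/
def standard (PM : ParamClass) : Diffeology PM ℝ where
  plaques _ := {p | PM.memReal p.dom p.toFun}
  covers x := ⟨0, ⟨⊤, fun _ => x⟩, PM.const ⊤ (fun _ => x), ⟨⟨0, trivial⟩, rfl⟩⟩
  glue _ S hS q hq := real_glue PM _ S hS q hq
  comp _ _ p hp U' φ hφ := PM.comp U' p.dom φ _ hφ hp

/-- `f` is a morphism if it maps plaques to plaques. -/
def IsMorphism {Y : Type*} (P : Diffeology PM X) (Q : Diffeology PM Y) (f : X → Y) : Prop :=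
  ∀ n, ∀ p ∈ P.plaques n, p.map f ∈ Q.plaques n

/-- `D(X)`: the morphisms from `X` to `ℝ` with its standard diffeology. -/
def realMaps (P : Diffeology PM X) : Set (X → ℝ) := {f | P.IsMorphism (standard PM) f}

/-- Two diffeologies on `X` are equivalent if they have the same real valued morphisms. -/
def Equivalent (P Q : Diffeology PM X) : Prop := P.realMaps = Q.realMaps

/-- The `1`-plaques with domain `ℝ`, as curves in `X`. -/
def curves (P : Diffeology PM X) : Set (ℝ → X) := {c | Plaque.ofCurve c ∈ P.plaques 1}

/-- `Γ F`: the diffeology of all plaques `p` such that `f ∘ p` is in `PM` for all `f ∈ F`. -/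
def ofFunctions (PM : ParamClass) (F : Set (X → ℝ)) : Diffeology PM X where
  plaques n := {p | ∀ f ∈ F, p.map f ∈ (standard PM).plaques n}
  covers x := ⟨0, ⟨⊤, fun _ => x⟩, fun f _ => PM.const ⊤ (fun _ => f x), ⟨⟨0, trivial⟩, rfl⟩⟩
  glue _ S hS q hq := by
    intro f hf
    refine PM.local_real _ _ fun x hx => ?_
    obtain ⟨p, hp, hxp⟩ := Plaque.exists_mem_of_isLUB hq ⟨x, hx⟩
    refine ⟨p.dom, (hq.1 hp).1, hxp, ?_⟩
    have h : PM.mem p.dom fun y (_ : Fin 1) => f (p.toFun y) := hS hp f hf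
    simp only [← (hq.1 hp).2] at h
    exact h
  comp _ _ p hp U' φ hφ := fun f hf => PM.comp U' p.dom φ _ hφ (hp f hf)

/-- `P` is maximal if `Γ Φ P = P`. -/
def IsMaximal (P : Diffeology PM X) : Prop := ofFunctions PM P.realMaps = P

end Diffeology

/-- A `PM`-diffeological space. -/
structure DiffSpace (PM : ParamClass) : Type (u + 1) where
  carrier : Type u
  str : Diffeology PM carrier

/-- The category of `PM`-diffeological spaces; the morphisms preserve plaques. -/
instance (PM : ParamClass) : Category (DiffSpace.{u} PM) where
  Hom X Y := {f : X.carrier → Y.carrier // X.str.IsMorphism Y.str f}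
  id X := ⟨id, fun _ _ hp => hp⟩
  comp f g := ⟨g.1 ∘ f.1, fun n p hp => g.2 n _ (f.2 n p hp)⟩

/-- `PM`-diffeological spaces, with the weaker notion of morphism given below. -/
structure WeakDiffSpace (PM : ParamClass) : Type (u + 1) where
  carrier : Type u
  str : Diffeology PM carrier

/-- The category of `PM`-diffeological spaces in which `f : X → Y` is a morphism if
`g ∈ D(Y)` implies `g ∘ f ∈ D(X)`. -/
instance (PM : ParamClass) : Category (WeakDiffSpace.{u} PM) where
  Hom X Y := {f : X.carrier → Y.carrier // ∀ g ∈ Y.str.realMaps, g ∘ f ∈ X.str.realMaps}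
  id X := ⟨id, fun _ hg => hg⟩
  comp f g := ⟨g.1 ∘ f.1, fun h hh => f.2 _ (g.2 h hh)⟩

/-- The spaces whose diffeology is maximal. -/
def isMaximalSpace (PM : ParamClass) : ObjectProperty (WeakDiffSpace.{u} PM) :=
  fun X => X.str.IsMaximal

/-- The category `PM₁`: its objects are the spaces with maximal diffeology, and its morphisms
`X → Y` are the maps `f` such that `g ∈ D(Y)` implies `g ∘ f ∈ D(X)`. -/
abbrev PMOne (PM : ParamClass) := (isMaximalSpace.{u} PM).FullSubcategory

/-- The identity on spaces and maps: every morphism of diffeological spaces is a morphism in the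
weaker sense. -/
def toWeak (PM : ParamClass) : DiffSpace.{u} PM ⥤ WeakDiffSpace.{u} PM where
  obj X := ⟨X.carrier, X.str⟩
  map f := ⟨f.1, fun _ hg n p hp => hg n _ (f.2 n p hp)⟩

/-- The `PM`-diffeology `Γ F` defined by an `M`-structure `(C, F)`. -/
def MStructure.toDiffeology (PM : ParamClass) {M : Set (ℝ → ℝ)} {X : Type u}
    (s : MStructure M X) : Diffeology PM X :=
  Diffeology.ofFunctions PM s.functions

/-- The `M`-structure generated by the `1`-plaques `ℝ → X` of a diffeology. -/
def Diffeology.toMStructure {PM : ParamClass} (M : Set (ℝ → ℝ)) {X : Type u}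
    (P : Diffeology PM X) : MStructure M X :=
  MStructure.generate M P.curves

/-- The functor `Ψ`: it sends `(X, C, F)` to `(X, Γ F)`, and is the identity on maps. -/
def psi (PM : ParamClass) (M : Set (ℝ → ℝ)) : MSpace.{u} M ⥤ DiffSpace.{u} PM where
  obj X := ⟨X.carrier, X.str.toDiffeology PM⟩
  map {X Y} f := ⟨f.1, fun n p hp h hh => hp (h ∘ f.1) <| by
    rw [← X.str.functionsOf_curves]
    intro c hc
    have hfc := f.2 c hc
    rw [← Y.str.curvesOf_functions] at hfc
    exact hfc h hh⟩

/-- The functor `Υ`: it sends `(X, P)` to `X` with the `M`-structure generated by the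
`1`-plaques `ℝ → X`, and is the identity on maps. -/
def upsilon (PM : ParamClass) (M : Set (ℝ → ℝ)) : DiffSpace.{u} PM ⥤ MSpace.{u} M where
  obj X := ⟨X.carrier, X.str.toMStructure M⟩
  map {X Y} f := ⟨f.1, fun c hc g hg => hc (g ∘ f.1) fun d hd => hg (f.1 ∘ d) (f.2 1 _ hd)⟩

/-! ## The classes `Lipᵏ` -/

/-- `Lipᵏ(ℝ, ℝ)`: the `Cᵏ` functions whose derivatives of all orders `j ≤ k` (`j` finite) are
locally Lipschitz. -/
def lipLine (k : ℕ∞) : Set (ℝ → ℝ) :=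
  {f | ContDiff ℝ k f ∧ ∀ j : ℕ, (j : ℕ∞) ≤ k → LocallyLipschitz (iteratedDeriv j f)}

/-- A map `f : U → ℝᵐ` on an open `U ⊆ ℝⁿ` is `Lipᵏ`: it is `Cᵏ`, and its derivatives of all
orders `j ≤ k` (`j` finite) are locally Lipschitz.  The derivatives on `U` are computed with any
extension `g` of `f` by arbitrary values outside of `U`. -/
def IsLip (k : ℕ∞) {n m : ℕ} (U : Opens (Fin n → ℝ)) (f : U → (Fin m → ℝ)) : Prop :=
  ∃ g : (Fin n → ℝ) → (Fin m → ℝ), (∀ x : U, g x = f x) ∧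
    ContDiffOn ℝ k g U ∧
      ∀ j : ℕ, (j : ℕ∞) ≤ k → LocallyLipschitzOn (U : Set (Fin n → ℝ)) (iteratedFDeriv ℝ j g)

section LipHelpers

/-- `f` is Lipschitz on a neighbourhood of `x`. -/
def LipNear {E F : Type*} [PseudoEMetricSpace E] [PseudoEMetricSpace F] (f : E → F) (x : E) :
    Prop :=
  ∃ K, ∃ t ∈ 𝓝 x, LipschitzOnWith K f t

theorem LipNear.congr {E F : Type*} [PseudoEMetricSpace E] [PseudoEMetricSpace F] {f g : E → F}
    {x : E} (hf : LipNear f x) (h : f =ᶠ[𝓝 x] g) : LipNear g x := by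
  obtain ⟨K, t, ht, hK⟩ := hf
  refine ⟨K, t ∩ {y | f y = g y}, Filter.inter_mem ht h, fun y hy z hz => ?_⟩
  rw [← hy.2, ← hz.2]
  exact hK hy.1 hz.1

theorem LipNear.comp {E F G : Type*} [PseudoEMetricSpace E] [PseudoEMetricSpace F]
    [PseudoEMetricSpace G] {f : E → F} {g : F → G} {x : E} (hg : LipNear g (f x))
    (hf : LipNear f x) : LipNear (g ∘ f) x := by
  obtain ⟨K, t, ht, hK⟩ := hf
  obtain ⟨L, s, hs, hL⟩ := hg
  have hc : ContinuousAt f x := hK.continuousOn.continuousAt ht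
  exact ⟨L * K, t ∩ f ⁻¹' s, Filter.inter_mem ht (hc hs),
    hL.comp (hK.mono Set.inter_subset_left) fun y hy => hy.2⟩

theorem LipNear.prodMk {E F G : Type*} [PseudoEMetricSpace E] [PseudoEMetricSpace F]
    [PseudoEMetricSpace G] {f : E → F} {g : E → G} {x : E} (hf : LipNear f x)
    (hg : LipNear g x) : LipNear (fun y => (f y, g y)) x := by
  obtain ⟨K, t, ht, hK⟩ := hf
  obtain ⟨L, s, hs, hL⟩ := hg
  exact ⟨max K L, t ∩ s, Filter.inter_mem ht hs,
    (hK.mono Set.inter_subset_left).prodMk (hL.mono Set.inter_subset_right)⟩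

theorem LipNear.pi {E ι : Type*} [Fintype ι] {F : ι → Type*} [PseudoEMetricSpace E]
    [∀ i, PseudoEMetricSpace (F i)] {f : ∀ i, E → F i} {x : E} (hf : ∀ i, LipNear (f i) x) :
    LipNear (fun y i => f i y) x := by
  choose K t ht hK using hf
  refine ⟨∑ i, K i, ⋂ i, t i, Filter.iInter_mem.2 ht, fun y hy z hz => ?_⟩
  refine edist_pi_le_iff.2 fun i => ?_
  refine (hK i (Set.mem_iInter.1 hy i) (Set.mem_iInter.1 hz i)).trans ?_
  gcongr
  exact_mod_cast Finset.single_le_sum (f := K) (fun _ _ => zero_le) (Finset.mem_univ i)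

theorem LipNear.sum {E F ι : Type*} [PseudoEMetricSpace E] [SeminormedAddCommGroup F]
    (s : Finset ι) {f : ι → E → F} {x : E} (hf : ∀ i ∈ s, LipNear (f i) x) :
    LipNear (fun y => ∑ i ∈ s, f i y) x := by
  classical
  induction s using Finset.induction_on with
  | empty => exact ⟨0, Set.univ, Filter.univ_mem, by
      simpa using LipschitzWith.const (α := E) (0 : F)⟩
  | insert a s ha ih =>
    obtain ⟨K, t, ht, hK⟩ := hf a (Finset.mem_insert_self a s)
    obtain ⟨L, r, hr, hL⟩ := ih fun i hi => hf i (Finset.mem_insert_of_mem hi)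
    refine ⟨K + L, t ∩ r, Filter.inter_mem ht hr, ?_⟩
    simp only [Finset.sum_insert ha]
    exact (hK.mono Set.inter_subset_left).add (hL.mono Set.inter_subset_right)

variable {E F G : Type*} [NormedAddCommGroup E] [NormedSpace ℝ E] [NormedAddCommGroup F]
  [NormedSpace ℝ F] [NormedAddCommGroup G] [NormedSpace ℝ G]

/-- `f` is `Cᵏ` at `x`, with derivatives Lipschitz near `x`. -/
def LipDiffAt (k : ℕ∞) (f : E → F) (x : E) : Prop :=
  ContDiffAt ℝ k f x ∧ ∀ j : ℕ, (j : ℕ∞) ≤ k → LipNear (iteratedFDeriv ℝ j f) x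

theorem LipDiffAt.congr {k : ℕ∞} {f g : E → F} {x : E} (hf : LipDiffAt k f x)
    (h : f =ᶠ[𝓝 x] g) : LipDiffAt k g x :=
  ⟨hf.1.congr_of_eventuallyEq h.symm, fun j hj => (hf.2 j hj).congr (h.iteratedFDeriv ℝ j)⟩

theorem lipDiffAt_const (k : ℕ∞) (y : F) (x : E) : LipDiffAt k (fun _ : E => y) x := by
  refine ⟨contDiffAt_const, fun j _ => ?_⟩
  rcases j with _ | j
  · refine ⟨0, Set.univ, Filter.univ_mem, LipschitzOnWith.of_dist_le_mul fun a _ b _ => ?_⟩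
    have : iteratedFDeriv ℝ 0 (fun _ : E => y) a = iteratedFDeriv ℝ 0 (fun _ : E => y) b := by
      ext v
      simp
    simp [this]
  · rw [iteratedFDeriv_const_of_ne (Nat.succ_ne_zero j)]
    exact ⟨0, Set.univ, Filter.univ_mem, (LipschitzWith.const 0).lipschitzOnWith⟩

theorem LipDiffAt.comp [CompleteSpace G] {k : ℕ∞} {f : E → F} {g : F → G} {U : Set E} (hU : IsOpen U)
    (hf : ∀ x ∈ U, LipDiffAt k f x) (hg : ∀ x ∈ U, LipDiffAt k g (f x)) {x : E} (hx : x ∈ U) :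
    LipDiffAt k (g ∘ f) x := by
  refine ⟨(hg x hx).1.comp x (hf x hx).1, fun j hj => ?_⟩
  have hf0 : LipNear f x := by
    obtain ⟨K, t, ht, hK⟩ := (hf x hx).2 0 zero_le
    refine ⟨K, t, ht, fun y hy z hz => ?_⟩
    have := hK hy hz
    rw [iteratedFDeriv_zero_eq_comp] at this
    simpa only [Function.comp_apply, LinearIsometryEquiv.edist_map] using this
  have key : LipNear (fun y => ∑ c : OrderedFinpartition j,
      c.compAlongOrderedFinpartitionL ℝ E F G (iteratedFDeriv ℝ c.length g (f y))
        (fun i => iteratedFDeriv ℝ (c.partSize i) f y)) x := by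
    refine LipNear.sum _ fun c _ => ?_
    let B := c.compAlongOrderedFinpartitionL ℝ E F G
    have hB : ∀ z, LipNear (fun p : (F [×c.length]→L[ℝ] G) ×
        (∀ i : Fin c.length, E [×c.partSize i]→L[ℝ] F) => B p.1 p.2) z := fun z =>
      ((B.analyticOnNhd_uncurry_of_multilinear z
        (Set.mem_univ z)).contDiffAt (n := 1)).exists_lipschitzOnWith
    have hc : ((c.length : ℕ) : ℕ∞) ≤ k := le_trans (by exact_mod_cast c.length_le) hj
    have hp : ∀ i, ((c.partSize i : ℕ) : ℕ∞) ≤ k := fun i =>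
      le_trans (by exact_mod_cast c.partSize_le i) hj
    exact (hB _).comp (f := fun y => (iteratedFDeriv ℝ c.length g (f y),
        fun i => iteratedFDeriv ℝ (c.partSize i) f y))
      ((((hg x hx).2 _ hc).comp hf0).prodMk (LipNear.pi fun i => (hf x hx).2 _ (hp i)))
  refine key.congr ?_
  filter_upwards [hU.mem_nhds hx] with y hy
  rw [iteratedFDeriv_comp (hg y hy).1 (hf y hy).1 (by exact_mod_cast hj)]
  rfl

theorem isLip_iff {k : ℕ∞} {n m : ℕ} {U : Opens (Fin n → ℝ)} {f : U → (Fin m → ℝ)} :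
    IsLip k U f ↔ ∃ g : (Fin n → ℝ) → (Fin m → ℝ), (∀ x : U, g x = f x) ∧
      ∀ x ∈ U, LipDiffAt k g x := by
  refine exists_congr fun g => and_congr_right fun _ => ⟨fun h x hx => ⟨?_, fun j hj => ?_⟩,
    fun h => ⟨fun x hx => (h x hx).1.contDiffWithinAt, fun j hj x hx => ?_⟩⟩
  · exact h.1.contDiffAt (U.isOpen.mem_nhds hx)
  · obtain ⟨K, t, ht, hK⟩ := h.2 j hj hx
    rw [U.isOpen.nhdsWithin_eq hx] at ht
    exact ⟨K, t, ht, hK⟩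
  · obtain ⟨K, t, ht, hK⟩ := (h x hx).2 j hj
    exact ⟨K, t, mem_nhdsWithin_of_mem_nhds ht, hK⟩

end LipHelpers

/-- The class `PM_Lᵏ` of `Lipᵏ` maps between open sets of Euclidean spaces. -/
def lipClass (k : ℕ∞) : ParamClass where
  mem U f := IsLip k U f
  continuous U f := by
    rintro ⟨g, hg, hc, -⟩
    have : f = Set.domRestrict U g := funext fun x => (hg x).symm
    rw [this]
    exact hc.continuousOn.domRestrict
  const U y := isLip_iff.2 ⟨fun _ => y, fun _ => rfl, fun x _ => lipDiffAt_const k y x⟩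
  comp U V f g hf hg := by
    obtain ⟨f', hf', hf⟩ := isLip_iff.1 hf
    obtain ⟨g', hg', hg⟩ := isLip_iff.1 hg
    refine isLip_iff.2 ⟨g' ∘ f', fun x => ?_, fun x hx => LipDiffAt.comp U.isOpen hf ?_ hx⟩
    · simp [hf', hg']
    · intro z hz
      rw [hf' ⟨z, hz⟩]
      exact hg _ (f ⟨z, hz⟩).2
  local_real {n} U f h := by
    classical
    refine isLip_iff.2 ⟨fun x => if hx : x ∈ U then f ⟨x, hx⟩ else 0, fun x => ?_, fun x hx => ?_⟩
    · simp
    · obtain ⟨V, hV, hxV, hm⟩ := h x hx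
      obtain ⟨g, hg, hl⟩ := isLip_iff.1 hm
      refine (hl x hxV).congr ?_
      filter_upwards [V.isOpen.mem_nhds hxV] with y hy
      rw [dif_pos (hV hy)]
      exact hg ⟨y, hy⟩

/-! ## Structures and diffeologies determined by their real valued maps -/

section Categorical

variable {PM : ParamClass} {X : Type u}

/-! The categorical statements are formal consequences of detection by curves. The curves of ΓF are
those of C by definition, so D(ΓF) = ΦC = F for every class. Conversely, let f be good along all
curves of P₁(X), and let p be a plaque. Since p ∘ γ lies in P₁(X) for each PM-curve γ, detection
applied to f ∘ p shows that f ∈ D(X) (`Diffeology.functions_toMStructure`). Hence ΥΨ is the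
identity, and ΨΥ replaces a diffeology by the maximal one with the same D. So Ψ becomes an
equivalence as soon as morphisms see only D.

The analytic content is that Lipᵏ is detected by curves (`lipClass_detectedByCurves`), a form of
Boman's theorem, which is proved with finite differences. For a Lipᵏ function on the line, the
differences of order j + 1 ≤ k + 1 with step s are O(s^(j+1)). If a function h of several variables
violated such a bound near a point, infinitely many violating segments could be strung on one smooth
curve, along which h would violate it too (`exists_fwdDiff_bound_of_curves`).

Conversely, difference bounds give regularity (`lipDiffAt_of_fwdDiff`). Mollification commutes with
differences, so it preserves the bounds. For smooth functions they bound the derivatives on the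
diagonal, and by polarization the full derivatives. A pointwise limit of smooth functions with
bounded derivatives of orders 1, …, k + 1 is C^{k,1} (`lipDiffAt_of_tendsto`). The case k = ∞
follows from the finite ones. -/

theorem MStructure.curves_toDiffeology (s : MStructure PM.lineMaps X) :
    (s.toDiffeology PM).curves = s.curves :=
  s.curvesOf_functions

theorem MStructure.realMaps_toDiffeology (s : MStructure PM.lineMaps X) :
    (s.toDiffeology PM).realMaps = s.functions := by
  refine Set.Subset.antisymm (fun f hf => ?_) fun f hf n p hp => hp f hf
  rw [← s.functionsOf_curves]
  intro c hc
  rw [← s.curves_toDiffeology] at hc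
  exact hf 1 _ hc

/-- Precomposing a plaque with a PM-curve gives an element of P₁(X), so the test along P₁(X)
contains the curve test for each f ∘ p. The categorical part uses detection only through this lemma.
-/
theorem Diffeology.functions_toMStructure (hPM : PM.DetectedByCurves) (P : Diffeology PM X) :
    (P.toMStructure PM.lineMaps).functions = P.realMaps := by
  refine Set.Subset.antisymm (fun f hf n p hp => ?_) fun f hf c hc => hf 1 _ hc
  exact (hPM n p.dom (f ∘ p.toFun)).2 fun γ hγ =>
    hf (p.toFun ∘ γ) (P.comp 1 n p hp ⊤ (fun t => γ (t.1 0)) hγ)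

theorem Diffeology.curves_subset_toMStructure {M : Set (ℝ → ℝ)} (P : Diffeology PM X) :
    P.curves ⊆ (P.toMStructure M).curves :=
  fun _ hc _ hf => hf _ hc

theorem Diffeology.toMStructure_curves_subset {M : Set (ℝ → ℝ)} (P : Diffeology PM X)
    (s : MStructure M X) (h : P.curves ⊆ s.curves) : (P.toMStructure M).curves ⊆ s.curves := by
  intro c hc
  rw [← s.curvesOf_functions]
  refine fun f hf => hc f fun d hd => ?_
  rw [← s.functionsOf_curves] at hf
  exact hf d (h hd)

theorem MStructure.toMStructure_toDiffeology (s : MStructure PM.lineMaps X) :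
    (s.toDiffeology PM).toMStructure PM.lineMaps = s := by
  have h : (s.toDiffeology PM).curves = s.curves := s.curves_toDiffeology
  have hF : functionsOf PM.lineMaps (s.toDiffeology PM).curves = s.functions := by
    rw [h, s.functionsOf_curves]
  ext1
  · change curvesOf _ (functionsOf _ _) = _
    rw [hF, s.curvesOf_functions]
  · exact hF

theorem MStructure.isMaximal_toDiffeology (s : MStructure PM.lineMaps X) :
    (s.toDiffeology PM).IsMaximal := by
  rw [Diffeology.IsMaximal, s.realMaps_toDiffeology]
  rfl

theorem Diffeology.realMaps_toDiffeology_toMStructure (hPM : PM.DetectedByCurves)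
    (P : Diffeology PM X) :
    ((P.toMStructure PM.lineMaps).toDiffeology PM).Equivalent P := by
  rw [Diffeology.Equivalent, MStructure.realMaps_toDiffeology, P.functions_toMStructure hPM]

theorem Diffeology.IsMaximal.toDiffeology_toMStructure (hPM : PM.DetectedByCurves)
    {P : Diffeology PM X} (hP : P.IsMaximal) :
    (P.toMStructure PM.lineMaps).toDiffeology PM = P := by
  rw [MStructure.toDiffeology, P.functions_toMStructure hPM]
  exact hP

end Categorical

/-! ### The functors Ψ and Υ, and the equivalences of categories -/

section Functors

variable (PM : ParamClass)

theorem psi_obj_injective : Function.Injective (psi.{u} PM PM.lineMaps).obj := by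
  rintro ⟨X, s⟩ ⟨Y, t⟩ h
  obtain ⟨rfl, h⟩ := DiffSpace.mk.inj h
  have h := eq_of_heq h
  congr 1
  rw [← s.toMStructure_toDiffeology, ← t.toMStructure_toDiffeology, h]

theorem psi_full : (psi.{u} PM PM.lineMaps).Full where
  map_surjective {X Y} f := by
    refine ⟨⟨f.1, fun c hc => ?_⟩, rfl⟩
    rw [← X.str.curves_toDiffeology] at hc
    rw [← Y.str.curves_toDiffeology]
    exact f.2 1 _ hc

theorem psi_faithful (M : Set (ℝ → ℝ)) : (psi.{u} PM M).Faithful where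
  map_injective h := Subtype.ext (congrArg (fun f => f.1) h)

theorem upsilon_faithful (M : Set (ℝ → ℝ)) : (upsilon.{u} PM M).Faithful where
  map_injective h := Subtype.ext (congrArg (fun f => f.1) h)

theorem psi_comp_upsilon_obj (X : MSpace.{u} PM.lineMaps) :
    (upsilon PM PM.lineMaps).obj ((psi PM PM.lineMaps).obj X) = X := by
  obtain ⟨X, s⟩ := X
  exact congrArg (MSpace.mk X) s.toMStructure_toDiffeology

/-- ΥΨ fixes objects only up to a propositional equality of structures, so its action on maps has to
be compared heterogeneously. -/
theorem MSpace.heq_of_str_eq {M : Set (ℝ → ℝ)} {X Y : Type u} {s s' : MStructure M X}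
    {t t' : MStructure M Y} (hs : s = s') (ht : t = t') (f : X → Y) (h : IsMMap s t f)
    (h' : IsMMap s' t' f) :
    HEq (⟨f, h⟩ : {f // IsMMap s t f}) (⟨f, h'⟩ : {f // IsMMap s' t' f}) := by
  subst hs ht
  rfl

theorem psi_comp_upsilon :
    psi.{u} PM PM.lineMaps ⋙ upsilon.{u} PM PM.lineMaps = 𝟭 (MSpace.{u} PM.lineMaps) := by
  refine Functor.hext (psi_comp_upsilon_obj PM) fun X Y f => ?_
  exact MSpace.heq_of_str_eq X.str.toMStructure_toDiffeology Y.str.toMStructure_toDiffeology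
    f.1 _ f.2

theorem upsilon_obj_surjective : Function.Surjective (upsilon.{u} PM PM.lineMaps).obj :=
  fun X => ⟨_, psi_comp_upsilon_obj PM X⟩

theorem psi_comp_toWeak_full : (psi.{u} PM PM.lineMaps ⋙ toWeak.{u} PM).Full where
  map_surjective {X Y} f := by
    refine ⟨⟨f.1, fun c hc => ?_⟩, rfl⟩
    rw [← Y.str.curvesOf_functions]
    intro g hg
    rw [← Y.str.realMaps_toDiffeology] at hg
    have hgf : g ∘ f.1 ∈ (X.str.toDiffeology PM).realMaps := f.2 g hg
    rw [X.str.realMaps_toDiffeology, ← X.str.functionsOf_curves] at hgf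
    exact hgf c hc

theorem psi_comp_toWeak_faithful (M : Set (ℝ → ℝ)) : (psi.{u} PM M ⋙ toWeak.{u} PM).Faithful where
  map_injective h := Subtype.ext (congrArg (fun f => f.1) h)

/-- The functor `Ψ` with values in the spaces with maximal diffeology. -/
def psiOne : MSpace.{u} PM.lineMaps ⥤ PMOne.{u} PM :=
  (isMaximalSpace PM).lift (psi PM PM.lineMaps ⋙ toWeak PM) fun X =>
    X.str.isMaximal_toDiffeology

variable {PM}

theorem psi_comp_toWeak_isEquivalence (hPM : PM.DetectedByCurves) :
    (psi.{u} PM PM.lineMaps ⋙ toWeak.{u} PM).IsEquivalence where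
  faithful := psi_comp_toWeak_faithful PM _
  full := psi_comp_toWeak_full PM
  essSurj := by
    refine ⟨fun Y => ⟨⟨Y.carrier, Y.str.toMStructure PM.lineMaps⟩, ⟨?_⟩⟩⟩
    have h : ((Y.str.toMStructure PM.lineMaps).toDiffeology PM).realMaps = Y.str.realMaps :=
      Y.str.realMaps_toDiffeology_toMStructure hPM
    -- The two diffeologies have the same D, and weak morphisms see nothing else; so the identity
    -- map is an isomorphism.
    exact
      { hom := ⟨id, fun g hg => h.symm.subset hg⟩
        inv := ⟨id, fun g hg => h.subset hg⟩
        hom_inv_id := rfl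
        inv_hom_id := rfl }

theorem psiOne_isEquivalence (hPM : PM.DetectedByCurves) : (psiOne.{u} PM).IsEquivalence where
  faithful :=
    have : (psiOne PM ⋙ (isMaximalSpace PM).ι).Faithful :=
      psi_comp_toWeak_faithful PM PM.lineMaps
    Functor.Faithful.of_comp (psiOne PM) (isMaximalSpace PM).ι
  full :=
    have : (psiOne PM ⋙ (isMaximalSpace PM).ι).Full := psi_comp_toWeak_full PM
    Functor.Full.of_comp_faithful (psiOne PM) (isMaximalSpace PM).ι
  essSurj := by
    refine ⟨fun Y => ⟨⟨Y.obj.carrier, Y.obj.str.toMStructure PM.lineMaps⟩, ⟨eqToIso ?_⟩⟩⟩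
    obtain ⟨⟨Y, P⟩, hP⟩ := Y
    have h : (P.toMStructure PM.lineMaps).toDiffeology PM = P :=
      Diffeology.IsMaximal.toDiffeology_toMStructure hPM hP
    refine ObjectProperty.FullSubcategory.ext ?_
    exact congrArg (WeakDiffSpace.mk Y) h

theorem exists_equivalence_PMOne (hPM : PM.DetectedByCurves) :
    ∃ e : MSpace.{u} PM.lineMaps ≌ PMOne.{u} PM,
      e.functor ⋙ (isMaximalSpace.{u} PM).ι = psi.{u} PM PM.lineMaps ⋙ toWeak.{u} PM :=
  have := psiOne_isEquivalence hPM
  ⟨(psiOne PM).asEquivalence, rfl⟩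

end Functors

/-! ## Iterated differences and derivatives of functions of one variable -/

section OneVariable

/-- Iterated mean value inequality, where `G i` plays the role of the i-th derivative. One
difference of the last but one derivative gains a factor s, and induction applies to the differenced
family. -/
theorem fwdDiff_iter_ge {j : ℕ} {G : ℕ → ℝ → ℝ} {t s A : ℝ} (hs : 0 ≤ s)
    (hG : ∀ i < j, ∀ u ∈ Set.Icc t (t + j * s), HasDerivAt (G i) (G (i + 1) u) u)
    (hA : ∀ u ∈ Set.Icc t (t + j * s), A ≤ G j u) :
    A * s ^ j ≤ (fwdDiff s)^[j] (G 0) t := by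
  induction j generalizing G A with
  | zero => simpa using hA t (by simp)
  | succ j ih =>
    have hmem : ∀ u ∈ Set.Icc t (t + j * s), ∀ w ∈ Set.Icc u (u + s),
        w ∈ Set.Icc t (t + (j + 1 : ℕ) * s) := by
      rintro u ⟨hu, hu'⟩ w ⟨hw, hw'⟩
      push_cast
      exact ⟨hu.trans hw, by linarith⟩
    have key : ∀ u ∈ Set.Icc t (t + j * s), A * s ≤ G j (u + s) - G j u := by
      intro u hu
      have hd : ∀ w ∈ Set.Icc u (u + s), HasDerivAt (G j) (G (j + 1) w) w := fun w hw =>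
        hG j (Nat.lt_succ_self j) w (hmem u hu w hw)
      have := (convex_Icc u (u + s)).mul_sub_le_image_sub_of_le_deriv (f := G j) (C := A)
        (fun w hw => (hd w hw).continuousAt.continuousWithinAt)
        (fun w hw => (hd w (interior_subset hw)).differentiableAt.differentiableWithinAt)
        (fun w hw => by
          rw [(hd w (interior_subset hw)).deriv]
          exact hA w (hmem u hu w (interior_subset hw)))
        u ⟨le_rfl, by linarith⟩ (u + s) ⟨by linarith, le_rfl⟩ (by linarith)
      simpa using this
    have h := ih (G := fun i => fwdDiff s (G i)) (A := A * s) (fun i hi u hu => ?_) key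
    · rw [Function.iterate_succ_apply]
      refine le_trans (le_of_eq ?_) h
      ring
    · have h1 := hG i (hi.trans (Nat.lt_succ_self j)) u (hmem u hu u ⟨le_rfl, by linarith⟩)
      have h2 := hG i (hi.trans (Nat.lt_succ_self j)) (u + s)
        (hmem u hu (u + s) ⟨by linarith, le_rfl⟩)
      exact (h2.comp_add_const u s).sub h1

theorem hasDerivAt_iteratedDeriv {g : ℝ → ℝ} {k : ℕ} (hg : ContDiff ℝ k g) {i : ℕ} (hi : i < k)
    (u : ℝ) : HasDerivAt (iteratedDeriv i g) (iteratedDeriv (i + 1) g u) u := by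
  rw [iteratedDeriv_succ]
  exact (hg.differentiable_iteratedDeriv i (by exact_mod_cast hi) u).hasDerivAt

/-- The `j + 1`-st differences of a `C^{j,1}` function are of order `s ^ (j + 1)`. -/
theorem abs_fwdDiff_iter_le {j : ℕ} {g : ℝ → ℝ} (hg : ContDiff ℝ j g) {t s L : ℝ} (hs : 0 ≤ s)
    (hL : ∀ u ∈ Set.Icc t (t + j * s),
      |iteratedDeriv j g (u + s) - iteratedDeriv j g u| ≤ L * s) :
    |(fwdDiff s)^[j + 1] g t| ≤ L * s ^ (j + 1) := by
  -- A derivative of order j + 1 need not exist. So one difference is taken first, and the mean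
  -- value inequality is applied j times to it, with the Lipschitz bound at the top order.
  have hd : ∀ i < j, ∀ u, HasDerivAt (fwdDiff s (iteratedDeriv i g))
      (fwdDiff s (iteratedDeriv (i + 1) g) u) u := fun i hi u =>
    ((hasDerivAt_iteratedDeriv hg hi (u + s)).comp_add_const u s).sub
      (hasDerivAt_iteratedDeriv hg hi u)
  have h1 := fwdDiff_iter_ge (G := fun i => fwdDiff s (iteratedDeriv i g)) (A := -(L * s)) hs
    (fun i hi u _ => hd i hi u) (fun u hu => (abs_le.1 (hL u hu)).1)
  have h2 := fwdDiff_iter_ge (G := fun i u => -fwdDiff s (iteratedDeriv i g) u) (A := -(L * s)) hs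
    (fun i hi u _ => (hd i hi u).neg) (fun u hu => neg_le_neg (abs_le.1 (hL u hu)).2)
  have h3 : (fwdDiff s)^[j] (fun u => -fwdDiff s (iteratedDeriv 0 g) u) t =
      -(fwdDiff s)^[j] (fwdDiff s g) t := by
    have := fwdDiff_iter_const_smul s (-1 : ℝ) (fwdDiff s g) j
    rw [iteratedDeriv_zero]
    have h := congrFun this t
    simp only [neg_smul, one_smul, Pi.smul_apply] at h
    exact h
  rw [h3] at h2
  simp only [iteratedDeriv_zero] at h1
  rw [Function.iterate_succ_apply, abs_le]
  have h4 : -(L * s) * s ^ j = -(L * s ^ (j + 1)) := by ring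
  constructor <;> linarith

/-- A bound on the `j`-th differences of a `C^j` function bounds its `j`-th derivative. -/
theorem iteratedDeriv_le_of_fwdDiff_iter_le {j : ℕ} {g : ℝ → ℝ} (hg : ContDiff ℝ j g) {C r : ℝ}
    (hr : 0 < r) (h : ∀ s, 0 < s → s < r → (fwdDiff s)^[j] g 0 ≤ C * s ^ j) :
    iteratedDeriv j g 0 ≤ C := by
  refine le_of_forall_lt fun A hA => ?_
  obtain ⟨B, hAB, hB⟩ := exists_between hA
  have hcont : Continuous (iteratedDeriv j g) := hg.continuous_iteratedDeriv j le_rfl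
  obtain ⟨δ, hδ, hball⟩ := Metric.eventually_nhds_iff.1
    (hcont.continuousAt.eventually (lt_mem_nhds hB))
  -- For so small a step the j-th derivative exceeds B on all of [0, js], so B s^j ≤ C s^j. Dividing
  -- by j + 1 rather than j covers j = 0.
  obtain ⟨s, hs, hs'⟩ := exists_between (lt_min hr (div_pos hδ (Nat.cast_add_one_pos (α := ℝ) j)))
  have hsδ : (j + 1) * s < δ := by
    have := hs'.trans_le (min_le_right _ _)
    rw [lt_div_iff₀ (Nat.cast_add_one_pos j)] at this
    linarith
  have h1 := fwdDiff_iter_ge (G := fun i => iteratedDeriv i g) (t := 0) (A := B) hs.le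
    (fun i hi u _ => hasDerivAt_iteratedDeriv hg hi u) (fun u hu => (hball (by
      rw [Real.dist_eq, sub_zero, abs_of_nonneg hu.1]
      nlinarith [hu.2])).le)
  have h2 := h s hs (hs'.trans_le (min_le_left _ _))
  rw [iteratedDeriv_zero] at h1
  exact hAB.trans_le (le_of_mul_le_mul_right (h1.trans h2) (pow_pos hs j))

end OneVariable

/-! ## Polarization -/

section Polarization

/-- Expand each diagonal value over the maps r from indices to indices whose image avoids T. For
fixed r the signs cancel unless the image is everything; the j! permutations remain, and by symmetry
each contributes f v. -/
theorem MultilinearMap.sum_neg_one_pow_mul_diag {j : ℕ} {E : Type*} [AddCommGroup E] [Module ℝ E]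
    (f : MultilinearMap ℝ (fun _ : Fin j => E) ℝ)
    (hf : ∀ (σ : Equiv.Perm (Fin j)) (v : Fin j → E), f (v ∘ σ) = f v) (v : Fin j → E) :
    ∑ T : Finset (Fin j), (-1 : ℝ) ^ T.card * f (fun _ => ∑ i ∈ Tᶜ, v i) = j.factorial * f v := by
  have h1 : ∀ T : Finset (Fin j), f (fun _ => ∑ i ∈ Tᶜ, v i) =
      ∑ r : Fin j → Fin j, if T ⊆ (Finset.univ.image r)ᶜ then f (v ∘ r) else 0 := by
    intro T
    rw [f.map_sum_finset (fun _ i => v i) (fun _ => Tᶜ), ← Finset.sum_filter]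
    refine Finset.sum_congr ?_ fun _ _ => rfl
    ext r
    simp only [Fintype.mem_piFinset, Finset.mem_compl, Finset.mem_filter, Finset.mem_univ,
      true_and, Finset.subset_iff, Finset.mem_image, not_exists]
    exact ⟨fun h x hx i hi => h i (hi ▸ hx), fun h i hi => h hi i rfl⟩
  have h2 : ∀ r : Fin j → Fin j, (∑ T : Finset (Fin j),
      (-1 : ℝ) ^ T.card * if T ⊆ (Finset.univ.image r)ᶜ then f (v ∘ r) else 0) =
        if Function.Bijective r then f v else 0 := by
    intro r
    have h3 : (∑ T ∈ (Finset.univ.image r)ᶜ.powerset, (-1 : ℝ) ^ T.card) =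
        if (Finset.univ.image r)ᶜ = ∅ then 1 else 0 := by
      exact_mod_cast Finset.sum_powerset_neg_one_pow_card (x := (Finset.univ.image r)ᶜ)
    simp only [mul_ite, mul_zero]
    rw [← Finset.sum_filter, ← Finset.sum_mul]
    have h4 : (Finset.univ.filter fun T => T ⊆ (Finset.univ.image r)ᶜ) =
        (Finset.univ.image r)ᶜ.powerset := by
      ext T
      simp
    have h5 : (Finset.univ.image r)ᶜ = ∅ ↔ Function.Bijective r := by
      rw [Finset.compl_eq_empty_iff, ← Finite.surjective_iff_bijective, Finset.eq_univ_iff_forall]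
      simp [Function.Surjective]
    rw [h4, h3]
    simp only [h5]
    split_ifs with hr
    · rw [one_mul]
      exact hf (Equiv.ofBijective r hr) v
    · rw [zero_mul]
  simp only [h1, Finset.mul_sum]
  rw [Finset.sum_comm]
  simp only [h2]
  rw [← Finset.sum_filter, Finset.sum_const, nsmul_eq_mul]
  congr 2
  rw [← Fintype.card_subtype, Fintype.card_congr Equiv.bijectiveEquiv, Fintype.card_perm,
    Fintype.card_fin]

/-- After normalizing the arguments, polarization has 2^j terms, each a diagonal value at a vector
of norm at most j. The factor j! ≥ 1 is dropped. -/
theorem ContinuousMultilinearMap.opNorm_le_of_diag {j : ℕ} {E : Type*} [NormedAddCommGroup E]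
    [NormedSpace ℝ E] (f : E [×j]→L[ℝ] ℝ)
    (hf : ∀ (σ : Equiv.Perm (Fin j)) (v : Fin j → E), f (v ∘ σ) = f v) {C : ℝ} (hC : 0 ≤ C)
    (h : ∀ v, |f fun _ => v| ≤ C * ‖v‖ ^ j) : ‖f‖ ≤ 2 ^ j * (C * j ^ j) := by
  refine f.opNorm_le_bound (by positivity) fun m => ?_
  let w : Fin j → E := fun i => ‖m i‖⁻¹ • m i
  have hm : m = fun i => ‖m i‖ • w i := by
    funext i
    rcases eq_or_ne (m i) 0 with h0 | h0
    · simp [w, h0]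
    · simp [w, smul_smul, mul_inv_cancel₀ (norm_ne_zero_iff.2 h0)]
  have hw : ∀ i, ‖w i‖ ≤ 1 := fun i => by
    rw [norm_smul, norm_inv, norm_norm]
    exact inv_mul_le_one
  have hfw : |f w| ≤ 2 ^ j * (C * j ^ j) := by
    have h1 := f.toMultilinearMap.sum_neg_one_pow_mul_diag hf w
    have h2 : |(j.factorial : ℝ) * f w| ≤ 2 ^ j * (C * j ^ j) := by
      rw [← show _ = (j.factorial : ℝ) * f w from h1]
      refine (Finset.abs_sum_le_sum_abs _ _).trans ?_
      refine (Finset.sum_le_card_nsmul _ _ (C * j ^ j) fun T _ => ?_).trans (le_of_eq ?_)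
      · rw [abs_mul, abs_pow, abs_neg, abs_one, one_pow, one_mul]
        refine (h _).trans ?_
        gcongr
        refine (norm_sum_le _ _).trans ?_
        refine (Finset.sum_le_card_nsmul _ _ 1 fun i _ => hw i).trans ?_
        rw [nsmul_eq_mul, mul_one]
        exact_mod_cast (Finset.card_le_univ _).trans_eq (Fintype.card_fin j)
      · simp
    refine le_trans ?_ h2
    rw [abs_mul, Nat.abs_cast]
    exact le_mul_of_one_le_left (abs_nonneg _) (by exact_mod_cast j.factorial_pos)
  have hfm : f m = (∏ i, ‖m i‖) * f w := by
    conv_lhs => rw [hm]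
    rw [f.map_smul_univ, smul_eq_mul]
  rw [hfm, norm_mul, mul_comm, Real.norm_of_nonneg (Finset.prod_nonneg fun i _ => norm_nonneg _)]
  gcongr
  exact hfw

end Polarization

/-! ## Limits of functions with bounded derivatives -/

section Limits

variable {E F : Type*} [NormedAddCommGroup E] [NormedSpace ℝ E] [NormedAddCommGroup F]
  [NormedSpace ℝ F]

theorem LipNear.iteratedFDeriv_zero {g : E → F} {x : E} (h : LipNear g x) :
    LipNear (iteratedFDeriv ℝ 0 g) x := by
  obtain ⟨K, t, ht, hK⟩ := h
  refine ⟨K, t, ht, fun y hy z hz => ?_⟩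
  rw [iteratedFDeriv_zero_eq_comp]
  simpa only [Function.comp_apply, LinearIsometryEquiv.edist_map] using hK hy hz

theorem LipDiffAt.succ {k : ℕ} {g : E → F} {A : E → E →L[ℝ] F} {x : E}
    (hg : ∀ᶠ y in 𝓝 x, HasFDerivAt g (A y) y) (hA : LipDiffAt k A x) (h0 : LipNear g x) :
    LipDiffAt (k + 1 : ℕ) g x := by
  have hA' : fderiv ℝ g =ᶠ[𝓝 x] A := hg.mono fun y hy => hy.fderiv
  refine ⟨?_, fun j hj => ?_⟩
  · obtain ⟨u, hu, hu'⟩ := hg.exists_mem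
    have := (contDiffAt_succ_iff_hasFDerivAt (n := k)).2 ⟨A, ⟨u, hu, hu'⟩, hA.1⟩
    exact_mod_cast this
  · rcases j with _ | j
    · exact h0.iteratedFDeriv_zero
    · have hj' : ((j : ℕ) : ℕ∞) ≤ k := by
        have : j + 1 ≤ k + 1 := by exact_mod_cast hj
        exact_mod_cast Nat.le_of_succ_le_succ this
      obtain ⟨K, t, ht, hK⟩ := (hA.congr hA'.symm).2 j hj'
      refine ⟨K, t, ht, fun y hy z hz => ?_⟩
      rw [iteratedFDeriv_succ_eq_comp_right (x := y), iteratedFDeriv_succ_eq_comp_right (x := z)]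
      simpa only [Function.comp_apply, LinearIsometryEquiv.edist_map] using hK hy hz

/-- Taylor's remainder by two mean value inequalities; the sharp constant C / 2 is not needed. -/
theorem Convex.norm_image_sub_sub_fderiv_le {f : E → F} {s : Set E} (hs : Convex ℝ s)
    (hf : ContDiff ℝ 2 f) {C : ℝ} (hC : 0 ≤ C)
    (h : ∀ x ∈ s, ‖fderiv ℝ (fderiv ℝ f) x‖ ≤ C) {x y : E} (hx : x ∈ s) (hy : y ∈ s) :
    ‖f y - f x - fderiv ℝ f x (y - x)‖ ≤ C * ‖y - x‖ ^ 2 := by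
  have hd : Differentiable ℝ (fderiv ℝ f) :=
    (hf.fderiv_right (m := 1) (by norm_num)).differentiable (by norm_num)
  have hsub : segment ℝ x y ⊆ s := hs.segment_subset hx hy
  have h1 : ∀ z ∈ segment ℝ x y, ‖fderiv ℝ f z - fderiv ℝ f x‖ ≤ C * ‖y - x‖ := fun z hz => by
    refine (hs.norm_image_sub_le_of_norm_fderiv_le (fun w _ => hd w) h hx (hsub hz)).trans ?_
    gcongr
    exact norm_sub_le_of_mem_segment hz
  refine ((convex_segment x y).norm_image_sub_le_of_norm_fderiv_le'
    (fun z _ => hf.differentiable (by norm_num) z) h1 (left_mem_segment ℝ x y)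
    (right_mem_segment ℝ x y)).trans (le_of_eq ?_)
  ring

theorem cauchySeq_of_forall_approx {F : Type*} [SeminormedAddCommGroup F] {a : ℕ → F}
    (h : ∀ ε > 0, ∃ u : ℕ → F, CauchySeq u ∧ ∀ n, ‖a n - u n‖ ≤ ε) : CauchySeq a := by
  refine Metric.cauchySeq_iff'.2 fun ε hε => ?_
  obtain ⟨u, hu, hau⟩ := h (ε / 4) (by positivity)
  obtain ⟨N, hN⟩ := Metric.cauchySeq_iff'.1 hu (ε / 4) (by positivity)
  refine ⟨N, fun n hn => ?_⟩
  have h1 := hau n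
  have h2 := hau N
  have h3 := hN n hn
  rw [dist_eq_norm] at h3 ⊢
  calc ‖a n - a N‖ = ‖(a n - u n) + (u n - u N) - (a N - u N)‖ := by congr 1; abel
    _ ≤ ‖a n - u n‖ + ‖u n - u N‖ + ‖a N - u N‖ :=
      (norm_sub_le _ _).trans (by gcongr; exact norm_add_le _ _)
    _ < ε := by linarith

/-- If functions converge pointwise and their second derivatives are uniformly bounded, then the
directional derivatives converge. -/
theorem cauchySeq_fderiv_apply {f : ℕ → E → F} {g : E → F} {a : E} {r C : ℝ}
    (hf : ∀ n, ContDiff ℝ 2 (f n)) (hC : 0 ≤ C)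
    (h : ∀ n, ∀ x ∈ Metric.ball a r, ‖fderiv ℝ (fderiv ℝ (f n)) x‖ ≤ C)
    (hlim : ∀ x ∈ Metric.ball a r, Filter.Tendsto (fun n => f n x) Filter.atTop (𝓝 (g x)))
    {x : E} (hx : x ∈ Metric.ball a r) (v : E) : CauchySeq fun n => fderiv ℝ (f n) x v := by
  refine cauchySeq_of_forall_approx fun ε hε => ?_
  have hmem : ∀ᶠ t : ℝ in 𝓝[>] 0, x + t • v ∈ Metric.ball a r := by
    have : Filter.Tendsto (fun t : ℝ => x + t • v) (𝓝[>] 0) (𝓝 x) := by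
      have h0 : Continuous fun t : ℝ => x + t • v := by fun_prop
      simpa using (h0.tendsto 0).mono_left nhdsWithin_le_nhds
    exact this (Metric.isOpen_ball.mem_nhds hx)
  have hsmall : ∀ᶠ t : ℝ in 𝓝[>] 0, C * (t * ‖v‖ ^ 2) < ε := by
    have : Filter.Tendsto (fun t : ℝ => C * (t * ‖v‖ ^ 2)) (𝓝[>] 0) (𝓝 0) := by
      have h0 : Continuous fun t : ℝ => C * (t * ‖v‖ ^ 2) := by fun_prop
      simpa using (h0.tendsto 0).mono_left nhdsWithin_le_nhds
    exact this.eventually (gt_mem_nhds hε)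
  obtain ⟨t, ⟨ht1, ht2⟩, ht⟩ := ((hmem.and hsmall).and self_mem_nhdsWithin).exists
  have ht : 0 < t := ht
  -- For fixed t the difference quotients converge with n, and by Taylor they are within C t ‖v‖² <
  -- ε of the derivatives, uniformly in n.
  refine ⟨fun n => t⁻¹ • (f n (x + t • v) - f n x),
    (((hlim _ ht1).sub (hlim x hx)).const_smul t⁻¹).cauchySeq, fun n => ?_⟩
  have key := (convex_ball a r).norm_image_sub_sub_fderiv_le (hf n) hC (h n) hx ht1
  rw [add_sub_cancel_left, map_smul, norm_smul, Real.norm_of_nonneg ht.le, mul_pow] at key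
  have : fderiv ℝ (f n) x v - t⁻¹ • (f n (x + t • v) - f n x) =
      -(t⁻¹ • (f n (x + t • v) - f n x - t • fderiv ℝ (f n) x v)) := by
    rw [smul_sub t⁻¹ (f n (x + t • v) - f n x), smul_smul, inv_mul_cancel₀ ht.ne', one_smul]
    abel
  rw [this, norm_neg, norm_smul, norm_inv, Real.norm_of_nonneg ht.le, inv_mul_le_iff₀ ht]
  nlinarith

/-- The Taylor estimate is uniform in n, so it passes to the limit: g(y) - g(x) - A(y - x) = O(‖y -
x‖²). -/
theorem hasFDerivAt_of_tendsto {f : ℕ → E → F} {g : E → F} {A : E →L[ℝ] F} {a : E} {r C : ℝ}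
    (hf : ∀ n, ContDiff ℝ 2 (f n)) (hC : 0 ≤ C)
    (h : ∀ n, ∀ x ∈ Metric.ball a r, ‖fderiv ℝ (fderiv ℝ (f n)) x‖ ≤ C)
    (hlim : ∀ x ∈ Metric.ball a r, Filter.Tendsto (fun n => f n x) Filter.atTop (𝓝 (g x)))
    {x : E} (hx : x ∈ Metric.ball a r)
    (hA : Filter.Tendsto (fun n => fderiv ℝ (f n) x) Filter.atTop (𝓝 A)) :
    HasFDerivAt g A x := by
  let ev (v : E) : (E →L[ℝ] F) →L[ℝ] F := ContinuousLinearMap.apply ℝ F v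
  have hb : (fun y => g y - g x - A (y - x)) =O[𝓝 x] fun y => ‖y - x‖ ^ 2 := by
    refine Asymptotics.IsBigO.of_bound C ?_
    filter_upwards [Metric.isOpen_ball.mem_nhds hx] with y hy
    rw [norm_pow, norm_norm]
    refine le_of_tendsto (((hlim y hy).sub (hlim x hx)).sub
      (((ev (y - x)).continuous.tendsto A).comp hA)).norm
      (Filter.Eventually.of_forall fun n => ?_)
    exact (convex_ball a r).norm_image_sub_sub_fderiv_le (hf n) hC (h n) hx hy
  have h1 := hb.hasFDerivAt (𝕜 := ℝ) (by norm_num)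
  have h2 := (h1.add (A.hasFDerivAt.comp x ((hasFDerivAt_id x).sub_const x))).add_const (g x)
  simp only [zero_add, ContinuousLinearMap.comp_id] at h2
  refine (h2.congr_of_eventuallyEq (Filter.Eventually.of_forall fun y => ?_)).congr_fderiv ?_
  · simp
  · ext; simp

/-- In finite dimension, convergence on the basis vectors is convergence in operator norm. -/
theorem exists_tendsto_fderiv {m : ℕ} {F : Type*} [NormedAddCommGroup F] [NormedSpace ℝ F]
    [CompleteSpace F] {f : ℕ → (Fin m → ℝ) → F} {g : (Fin m → ℝ) → F} {a : Fin m → ℝ} {r C : ℝ}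
    (hf : ∀ n, ContDiff ℝ 2 (f n)) (hC : 0 ≤ C)
    (h : ∀ n, ∀ x ∈ Metric.ball a r, ‖fderiv ℝ (fderiv ℝ (f n)) x‖ ≤ C)
    (hlim : ∀ x ∈ Metric.ball a r, Filter.Tendsto (fun n => f n x) Filter.atTop (𝓝 (g x)))
    {x : Fin m → ℝ} (hx : x ∈ Metric.ball a r) :
    ∃ A, Filter.Tendsto (fun n => fderiv ℝ (f n) x) Filter.atTop (𝓝 A) := by
  let e := ContinuousLinearEquiv.piRing (𝕜 := ℝ) (E := F) (Fin m)
  have hl : ∀ i, ∃ l, Filter.Tendsto (fun n => e (fderiv ℝ (f n) x) i) Filter.atTop (𝓝 l) :=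
    fun i => cauchySeq_tendsto_of_complete
      (cauchySeq_fderiv_apply hf hC h hlim hx (Pi.single i 1))
  choose l hl using hl
  refine ⟨e.symm l, ?_⟩
  have := (e.symm.continuous.tendsto l).comp (tendsto_pi_nhds.2 hl)
  simpa [Function.comp_def] using this

/-- A pointwise limit of smooth functions whose derivatives of orders `1, …, k + 1` are uniformly
bounded is `C^{k,1}`. -/
theorem lipDiffAt_of_tendsto {m : ℕ} {a : Fin m → ℝ} {r : ℝ} (k : ℕ) :
    ∀ {F : Type} [NormedAddCommGroup F] [NormedSpace ℝ F] [CompleteSpace F]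
      {f : ℕ → (Fin m → ℝ) → F} {g : (Fin m → ℝ) → F}, (∀ n, ContDiff ℝ (⊤ : ℕ∞) (f n)) →
      (∀ j, j ≤ k → ∃ C, ∀ n, ∀ x ∈ Metric.ball a r, ‖iteratedFDeriv ℝ (j + 1) (f n) x‖ ≤ C) →
      (∀ x ∈ Metric.ball a r, Filter.Tendsto (fun n => f n x) Filter.atTop (𝓝 (g x))) →
      ∀ x ∈ Metric.ball a r, LipDiffAt k g x := by
  induction k with
  | zero =>
    intro F _ _ _ f g hf hC hlim x hx
    obtain ⟨C, hC⟩ := hC 0 le_rfl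
    have h1 : LipNear g x := by
      refine ⟨C.toNNReal, Metric.ball a r, Metric.isOpen_ball.mem_nhds hx,
        LipschitzOnWith.of_dist_le_mul fun y hy z hz => ?_⟩
      rw [dist_eq_norm, dist_eq_norm]
      refine le_of_tendsto ((hlim y hy).sub (hlim z hz)).norm
        (Filter.Eventually.of_forall fun n => ?_)
      refine (convex_ball a r).norm_image_sub_le_of_norm_fderiv_le
        (fun w _ => (hf n).differentiable (by simp) w) (fun w hw => ?_) hz hy
      rw [← norm_iteratedFDeriv_one]
      exact (hC n w hw).trans (Real.le_coe_toNNReal C)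
    refine ⟨?_, fun j hj => ?_⟩
    · obtain ⟨K, t, ht, hK⟩ := h1
      exact contDiffAt_zero.2 ⟨t, ht, hK.continuousOn⟩
    · obtain rfl : j = 0 := by simpa using hj
      exact h1.iteratedFDeriv_zero
  | succ k ih =>
    intro F _ _ _ f g hf hC hlim x hx
    have hf2 : ∀ n, ContDiff ℝ 2 (f n) := fun n => by
      exact_mod_cast contDiff_infty.1 (hf n) 2
    obtain ⟨C, hC1⟩ := hC 1 (by omega)
    have hC2 : ∀ n, ∀ y ∈ Metric.ball a r, ‖fderiv ℝ (fderiv ℝ (f n)) y‖ ≤ C := fun n y hy => by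
      rw [← norm_iteratedFDeriv_one, norm_iteratedFDeriv_fderiv]
      exact hC1 n y hy
    have hC0 : 0 ≤ C := (norm_nonneg (fderiv ℝ (fderiv ℝ (f 0)) x)).trans (hC2 0 x hx)
    have hA : ∀ y, ∃ A, y ∈ Metric.ball a r →
        Filter.Tendsto (fun n => fderiv ℝ (f n) y) Filter.atTop (𝓝 A) := fun y => by
      by_cases hy : y ∈ Metric.ball a r
      · exact (exists_tendsto_fderiv hf2 hC0 hC2 hlim hy).imp fun A h _ => h
      · exact ⟨0, fun h => absurd h hy⟩
    choose A hA using hA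
    refine LipDiffAt.succ (A := A) ?_ ?_ ?_
    · filter_upwards [Metric.isOpen_ball.mem_nhds hx] with y hy
      exact hasFDerivAt_of_tendsto hf2 hC0 hC2 hlim hy (hA y hy)
    -- The derivatives converge pointwise to A and inherit the bounds shifted by one order. This is
    -- why the induction runs over all target spaces F.
    · refine ih (fun n => (hf n).fderiv_right (by simp)) (fun j hj => ?_) hA x hx
      obtain ⟨C, hC⟩ := hC (j + 1) (by omega)
      refine ⟨C, fun n y hy => ?_⟩
      rw [norm_iteratedFDeriv_fderiv]
      exact hC n y hy
    · have := (ih hf (fun j hj => hC j (by omega)) hlim x hx).2 0 (by simp)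
      obtain ⟨K, t, ht, hK⟩ := this
      refine ⟨K, t, ht, fun y hy z hz => ?_⟩
      have := hK hy hz
      rw [iteratedFDeriv_zero_eq_comp] at this
      simpa only [Function.comp_apply, LinearIsometryEquiv.edist_map] using this

end Limits

/-! ## Smooth curves through rapidly converging segments -/

section SpecialCurve

theorem exists_bound_iteratedFDeriv {ψ : ℝ → ℝ} (hψ : ContDiff ℝ (⊤ : ℕ∞) ψ)
    (hc : HasCompactSupport ψ) (N : ℕ) :
    ∃ B, ∀ i ≤ N, ∀ t, ‖iteratedFDeriv ℝ i ψ t‖ ≤ B := by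
  have h : ∀ i : ℕ, ∃ B, ∀ t, ‖iteratedFDeriv ℝ i ψ t‖ ≤ B := fun i =>
    (hψ.continuous_iteratedFDeriv (m := i)
      (by exact_mod_cast le_top)).bounded_above_of_compact_support (hc.iteratedFDeriv i)
  choose B hB using h
  refine ⟨∑ i ∈ Finset.range (N + 1), B i, fun i hi t => (hB i t).trans ?_⟩
  exact Finset.single_le_sum (f := B) (fun i _ => (norm_nonneg _).trans (hB i 0))
    (Finset.mem_range.2 (Nat.lt_succ_of_le hi))

/-- For n < l the centres are at least 2⁻ⁿ/2 apart, while the radii add up to at most 3/8 of 2⁻ⁿ. -/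
theorem eq_of_mem_dyadic_windows {t : ℝ} {n l : ℕ} (hn : |t - (1 / 2) ^ n| ≤ (1 / 2) ^ n / 4)
    (hl : |t - (1 / 2) ^ l| ≤ (1 / 2) ^ l / 4) : n = l := by
  have aux : ∀ {n l : ℕ}, n < l → |t - (1 / 2) ^ n| ≤ (1 / 2) ^ n / 4 →
      |t - (1 / 2) ^ l| ≤ (1 / 2) ^ l / 4 → False := by
    intro n l hnl hn hl
    have h1 : (1 / 2 : ℝ) ^ l ≤ (1 / 2) ^ (n + 1) :=
      pow_le_pow_of_le_one (by norm_num) (by norm_num) hnl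
    have h2 : (0 : ℝ) < (1 / 2) ^ n := by positivity
    rw [pow_succ] at h1
    linarith [(abs_le.1 hn).1, (abs_le.1 hl).2]
  rcases lt_trichotomy n l with h | h | h
  · exact (aux h hn hl).elim
  · exact h
  · exact (aux h hl hn).elim

variable {E : Type*} [NormedAddCommGroup E] [NormedSpace ℝ E]

theorem norm_iteratedFDeriv_smul_const_le {ψ : ℝ → ℝ} (hψ : ContDiff ℝ (⊤ : ℕ∞) ψ) (p : E)
    (i : ℕ) (t : ℝ) :
    ‖iteratedFDeriv ℝ i (fun t => ψ t • p) t‖ ≤ ‖p‖ * ‖iteratedFDeriv ℝ i ψ t‖ := by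
  have := (ContinuousLinearMap.toSpanSingleton ℝ p).norm_iteratedFDeriv_comp_left
    (hψ.contDiffAt (x := t)) (n := i) (by exact_mod_cast le_top)
  simpa [Function.comp_def] using this

/-- Segments which converge to `0` rapidly enough lie on a smooth curve, which passes through the
`n`-th one at the time `2⁻ⁿ`. -/
theorem exists_curve_through_segments [CompleteSpace E] {R : ℝ} (hR : 0 < R) :
    ∃ ρ : ℕ → ℝ, (∀ n, 0 < ρ n) ∧ ∀ p q : ℕ → E, (∀ n, ‖p n‖ ≤ ρ n) → (∀ n, ‖q n‖ ≤ ρ n) →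
      ∃ c : ℝ → E, ContDiff ℝ (⊤ : ℕ∞) c ∧ (∀ t, ‖c t‖ < R) ∧
        ∀ (n : ℕ) (t : ℝ), |t - (1 / 2) ^ n| ≤ (1 / 2) ^ n / 8 →
          c t = p n + (t - (1 / 2) ^ n) • q n := by
  let φ : ∀ n : ℕ, ContDiffBump ((1 / 2 : ℝ) ^ n) := fun n =>
    ⟨(1 / 2) ^ n / 8, (1 / 2) ^ n / 4, by positivity, by
      have : (0 : ℝ) < (1 / 2) ^ n := by positivity
      linarith⟩
  let ψ : ℕ → ℝ → ℝ := fun n t => φ n t * (t - (1 / 2) ^ n)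
  have hφ : ∀ n, ContDiff ℝ (⊤ : ℕ∞) (φ n) := fun n => (φ n).contDiff
  have hψ : ∀ n, ContDiff ℝ (⊤ : ℕ∞) (ψ n) := fun n =>
    (hφ n).mul (contDiff_id.sub contDiff_const)
  have hB : ∀ n, ∃ B, 0 < B ∧ (∀ i ≤ n, ∀ t, ‖iteratedFDeriv ℝ i (φ n) t‖ ≤ B) ∧
      ∀ i ≤ n, ∀ t, ‖iteratedFDeriv ℝ i (ψ n) t‖ ≤ B := fun n => by
    obtain ⟨B, hB⟩ := exists_bound_iteratedFDeriv (hφ n) (φ n).hasCompactSupport n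
    obtain ⟨B', hB'⟩ := exists_bound_iteratedFDeriv (hψ n) (φ n).hasCompactSupport.mul_right n
    refine ⟨max 1 (max B B'), by positivity, fun i hi t => (hB i hi t).trans ?_,
      fun i hi t => (hB' i hi t).trans ?_⟩ <;> simp
  choose B hB0 hBφ hBψ using hB
  -- B n bounds the first n derivatives of both bumps, so the i-th derivative of the n-th term is at
  -- most (R/4) 2⁻ⁿ once n ≥ i. This gives smoothness of the sum, and norm at most R/2.
  refine ⟨fun n => R / 8 * (1 / 2) ^ n / B n, fun n => by have := hB0 n; positivity,
    fun p q hp hq => ?_⟩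
  let f : ℕ → ℝ → E := fun n t => φ n t • p n + ψ n t • q n
  have hf : ∀ n, ContDiff ℝ (⊤ : ℕ∞) (f n) := fun n =>
    ((hφ n).smul contDiff_const).add ((hψ n).smul contDiff_const)
  have hfb : ∀ n, ∀ i ≤ n, ∀ t, ‖iteratedFDeriv ℝ i (f n) t‖ ≤ R / 4 * (1 / 2) ^ n := by
    intro n i hi t
    have h1 : iteratedFDeriv ℝ i (f n) t = iteratedFDeriv ℝ i (fun t => φ n t • p n) t +
        iteratedFDeriv ℝ i (fun t => ψ n t • q n) t :=
      iteratedFDeriv_add_apply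
        (((hφ n).smul contDiff_const).contDiffAt.of_le (by exact_mod_cast le_top))
        (((hψ n).smul contDiff_const).contDiffAt.of_le (by exact_mod_cast le_top))
    have h2 : ∀ {w : E} {b : ℝ}, ‖w‖ ≤ R / 8 * (1 / 2) ^ n / B n → b ≤ B n → 0 ≤ b →
        ‖w‖ * b ≤ R / 8 * (1 / 2) ^ n := by
      intro w b hw hb hb0
      refine (mul_le_mul hw hb hb0 ((norm_nonneg _).trans hw)).trans_eq ?_
      exact div_mul_cancel₀ _ (hB0 n).ne'
    rw [h1]
    refine (norm_add_le _ _).trans ?_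
    have h3 := (norm_iteratedFDeriv_smul_const_le (hφ n) (p n) i t).trans
      (h2 (hp n) (hBφ n i hi t) (norm_nonneg _))
    have h4 := (norm_iteratedFDeriv_smul_const_le (hψ n) (q n) i t).trans
      (h2 (hq n) (hBψ n i hi t) (norm_nonneg _))
    linarith
  have hsum : HasSum (fun n : ℕ => R / 4 * (1 / 2 : ℝ) ^ n) (R / 2) := by
    have := hasSum_geometric_two.mul_left (R / 4)
    rwa [show R / 4 * 2 = R / 2 by ring] at this
  refine ⟨fun t => ∑' n, f n t, ?_, fun t => ?_, fun n t ht => ?_⟩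
  · refine contDiff_tsum_of_eventually (v := fun _ n => R / 4 * (1 / 2) ^ n) hf
      (fun _ _ => hsum.summable) fun i _ => ?_
    rw [Nat.cofinite_eq_atTop]
    filter_upwards [Filter.eventually_ge_atTop i] with n hn t using hfb n i hn t
  · refine (tsum_of_norm_bounded hsum fun n => ?_).trans_lt (by linarith)
    simpa using hfb n 0 n.zero_le t
  · have h0 : ∀ l, l ≠ n → f l t = 0 := by
      intro l hl
      have : φ l t = 0 := by
        refine (φ l).zero_of_le_dist ?_
        by_contra! hlt
        refine hl (eq_of_mem_dyadic_windows (t := t) (by exact hlt.le) (ht.trans ?_))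
        have : (0 : ℝ) < (1 / 2) ^ n := by positivity
        linarith
      simp [f, ψ, this]
    have h1 : φ n t = 1 := (φ n).one_of_mem_closedBall ht
    change ∑' l, f l t = _
    rw [tsum_eq_single n h0]
    simp [f, ψ, h1]

/-- If the composites of `h` with smooth curves have `j + 1`-st differences of order
`s ^ (j + 1)`, then so has `h`, locally uniformly. -/
theorem exists_fwdDiff_bound_of_curves [CompleteSpace E] {U : Set E} (hU : IsOpen U) {h : E → ℝ}
    {j : ℕ}
    (hc : ∀ c : ℝ → E, ContDiff ℝ (⊤ : ℕ∞) c → (∀ t, c t ∈ U) →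
      ∃ L, ∀ t ∈ Set.Icc (0 : ℝ) 1, ∀ s ∈ Set.Icc (0 : ℝ) 1,
        |(fwdDiff s)^[j + 1] (h ∘ c) t| ≤ L * s ^ (j + 1))
    {a : E} (ha : a ∈ U) :
    ∃ C, ∃ r > 0, ∀ x v : E, ‖x - a‖ < r → ‖v‖ < r →
      |(fwdDiff v)^[j + 1] h x| ≤ C * ‖v‖ ^ (j + 1) := by
  obtain ⟨R, hR, hRU⟩ := Metric.isOpen_iff.1 hU a ha
  obtain ⟨ρ, hρ, hcurve⟩ := exists_curve_through_segments (E := E) hR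
  by_contra! hbad
  have hr : ∀ n : ℕ, 0 < min (ρ n) (ρ n * ((1 / 2) ^ n / 8) / (j + 1)) := fun n => by
    have := hρ n
    positivity
  -- The curve will run through x n with velocity of norm ρ n, so v n corresponds to the time step s
  -- n = ‖v n‖ / ρ n. The chosen constant turns the violation into n · s n ^ (j + 1), and the radius
  -- keeps all j + 2 sample times in the n-th window.
  choose x v hx hv hxv using fun n : ℕ => hbad (n / ρ n ^ (j + 1)) _ (hr n)
  have hv0 : ∀ n, 0 < ‖v n‖ := by
    intro n
    refine norm_pos_iff.2 fun h0 => ?_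
    have := hxv n
    rw [h0, Function.iterate_succ_apply'] at this
    simp [fwdDiff] at this
  let s : ℕ → ℝ := fun n => ‖v n‖ / ρ n
  have hs0 : ∀ n, 0 < s n := fun n => div_pos (hv0 n) (hρ n)
  have hs : ∀ n, (j + 1) * s n ≤ (1 / 2) ^ n / 8 := fun n => by
    have h1 := (hv n).le.trans (min_le_right _ _)
    rw [le_div_iff₀ (by positivity)] at h1
    rw [← mul_div_assoc, div_le_iff₀ (hρ n)]
    linarith
  obtain ⟨c, hcs, hcR, hcn⟩ := hcurve (fun n => x n - a) (fun n => (s n)⁻¹ • v n)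
    (fun n => (hx n).le.trans (min_le_left _ _)) (fun n => by
      rw [norm_smul, norm_inv, Real.norm_of_nonneg (hs0 n).le, inv_div,
        div_mul_cancel₀ _ (hv0 n).ne'])
  obtain ⟨L, hL⟩ := hc (fun t => a + c t) (contDiff_const.add hcs) fun t => hRU (by
    simpa [Metric.mem_ball, dist_eq_norm] using hcR t)
  obtain ⟨n, hn⟩ := exists_nat_gt L
  have hp1 : (1 / 2 : ℝ) ^ n ≤ 1 := pow_le_one₀ (by norm_num) (by norm_num)
  have key : (fwdDiff (s n))^[j + 1] (h ∘ fun t => a + c t) ((1 / 2) ^ n) =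
      (fwdDiff (v n))^[j + 1] h (x n) := by
    rw [fwdDiff_iter_eq_sum_shift, fwdDiff_iter_eq_sum_shift]
    refine Finset.sum_congr rfl fun i hi => ?_
    have hi : (i : ℝ) ≤ j + 1 := by
      exact_mod_cast Nat.le_of_lt_succ (Finset.mem_range.1 hi)
    rw [Function.comp_apply, hcn n, add_sub_cancel_left, smul_assoc, smul_smul,
      mul_inv_cancel₀ (hs0 n).ne', one_smul, ← add_assoc, add_sub_cancel]
    rw [add_sub_cancel_left, nsmul_eq_mul, abs_of_nonneg (by have := hs0 n; positivity)]
    exact (mul_le_mul_of_nonneg_right hi (hs0 n).le).trans (hs n)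
  have h1 := hL ((1 / 2) ^ n) ⟨by positivity, hp1⟩ (s n) ⟨(hs0 n).le, by
    nlinarith [hs n, hs0 n, (Nat.cast_nonneg j : (0 : ℝ) ≤ j)]⟩
  rw [key] at h1
  have h2 := (hxv n).trans_le h1
  rw [div_pow, div_mul_eq_mul_div, ← mul_div_assoc,
    div_lt_div_iff_of_pos_right (pow_pos (hρ n) _)] at h2
  exact absurd (lt_of_mul_lt_mul_right h2 (by positivity)) hn.not_gt

end SpecialCurve

/-! ## Symmetry of iterated derivatives -/

section Symmetry

variable {E F : Type*} [NormedAddCommGroup E] [NormedSpace ℝ E] [NormedAddCommGroup F]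
  [NormedSpace ℝ F]

/-- Swapping the first two slots is symmetry of the second derivative of an iterated derivative. A
later swap leaves the first slot alone, so it comes from differentiating the identity one order
below. -/
theorem iteratedFDeriv_comp_swap {f : E → F} (hf : ContDiff ℝ (⊤ : ℕ∞) f) {n : ℕ} (i : Fin n)
    (x : E) (v : Fin (n + 1) → E) :
    iteratedFDeriv ℝ (n + 1) f x (v ∘ Equiv.swap i.castSucc i.succ) =
      iteratedFDeriv ℝ (n + 1) f x v := by
  have hs : ∀ j : ℕ, ContDiff ℝ (⊤ : ℕ∞) (iteratedFDeriv ℝ j f) := fun j =>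
    hf.iteratedFDeriv_right (by exact_mod_cast le_top)
  induction n generalizing x with
  | zero => exact i.elim0
  | succ n ih =>
    refine Fin.cases ?_ (fun i => ?_) i
    · have key : ∀ m : Fin (n + 2) → E, iteratedFDeriv ℝ (n + 2) f x m =
          fderiv ℝ (fderiv ℝ (iteratedFDeriv ℝ n f)) x (m 0) (m 1) (Fin.tail (Fin.tail m)) := by
        intro m
        have hg : DifferentiableAt ℝ (fderiv ℝ (iteratedFDeriv ℝ n f)) x :=
          ((hs n).fderiv_right (m := (⊤ : ℕ∞)) (by simp)).differentiable (by simp) x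
        have h1 : HasFDerivAt (fun y => iteratedFDeriv ℝ (n + 1) f y (Fin.tail m)) _ x :=
          (hg.hasFDerivAt.clm_apply (hasFDerivAt_const (m 1) x)).continuousMultilinear_apply_const
            (Fin.tail (Fin.tail m))
        rw [iteratedFDeriv_succ_apply_left, ← fderiv_continuousMultilinear_apply_const_apply
          ((hs (n + 1)).differentiable (by simp) x), h1.fderiv]
        simp
      have hsymm : IsSymmSndFDerivAt ℝ (iteratedFDeriv ℝ n f) x :=
        (hs n).contDiffAt.isSymmSndFDerivAt (by
          rw [minSmoothness_of_isRCLikeNormedField]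
          exact WithTop.coe_le_coe.2 le_top)
      rw [key, key, hsymm.eq]
      have htail : Fin.tail (Fin.tail (v ∘ Equiv.swap (Fin.castSucc 0) (Fin.succ 0))) =
          Fin.tail (Fin.tail v) := by
        funext j
        simp only [Fin.tail, Function.comp_apply]
        rw [Equiv.swap_apply_of_ne_of_ne]
        · exact Fin.succ_ne_zero _
        · intro h
          exact Fin.succ_ne_zero _ (Fin.succ_injective _ h)
      rw [htail]
      simp
    · have hd : DifferentiableAt ℝ (iteratedFDeriv ℝ (n + 1) f) x :=
        (hs (n + 1)).differentiable (by simp) x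
      have htail : Fin.tail (v ∘ Equiv.swap i.succ.castSucc i.succ.succ) =
          Fin.tail v ∘ Equiv.swap i.castSucc i.succ := by
        funext j
        simp only [Fin.tail, Function.comp_apply]
        rw [← Fin.succ_castSucc, ← (Fin.succ_injective _).map_swap]
      have h0 : (v ∘ Equiv.swap i.succ.castSucc i.succ.succ) 0 = v 0 := by
        rw [Function.comp_apply, Equiv.swap_apply_of_ne_of_ne]
        · rw [← Fin.succ_castSucc]
          exact (Fin.succ_ne_zero _).symm
        · exact (Fin.succ_ne_zero _).symm
      rw [iteratedFDeriv_succ_apply_left, iteratedFDeriv_succ_apply_left, h0, htail,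
        ← fderiv_continuousMultilinear_apply_const_apply hd,
        ← fderiv_continuousMultilinear_apply_const_apply hd]
      simp only [ih i]

/-- The iterated derivatives of a smooth function are symmetric. -/
theorem ContDiff.iteratedFDeriv_comp_perm {f : E → F} (hf : ContDiff ℝ (⊤ : ℕ∞) f) {n : ℕ}
    (x : E) (σ : Equiv.Perm (Fin n)) (v : Fin n → E) :
    iteratedFDeriv ℝ n f x (v ∘ σ) = iteratedFDeriv ℝ n f x v := by
  rcases n with _ | n
  · congr 1
    exact Subsingleton.elim _ _
  · have hσ : σ ∈ Submonoid.closure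
        (Set.range fun i : Fin n => Equiv.swap i.castSucc i.succ) := by
      rw [Equiv.Perm.mclosure_swap_castSucc_succ]
      trivial
    induction hσ using Submonoid.closure_induction generalizing v with
    | mem σ h =>
      obtain ⟨i, rfl⟩ := h
      exact iteratedFDeriv_comp_swap hf i x v
    | one => rfl
    | mul σ τ _ _ hσ hτ =>
      rw [Equiv.Perm.coe_mul, ← Function.comp_assoc, hτ, hσ]

end Symmetry

/-! ## Functions with bounded differences -/

section Mollification

open MeasureTheory

open scoped Convolution

variable {E : Type*} [NormedAddCommGroup E] [NormedSpace ℝ E]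

theorem iteratedDeriv_comp_line {f : E → ℝ} (hf : ContDiff ℝ (⊤ : ℕ∞) f) (x v : E) (j : ℕ) :
    iteratedDeriv j (fun t : ℝ => f (x + t • v)) 0 = iteratedFDeriv ℝ j f x fun _ => v := by
  have h1 : ContDiff ℝ (⊤ : ℕ∞) fun y => f (x + y) := hf.comp (contDiff_const.add contDiff_id)
  have h2 := (ContinuousLinearMap.toSpanSingleton ℝ v).iteratedFDeriv_comp_right h1 (0 : ℝ)
    (i := j) (by exact_mod_cast le_top)
  rw [iteratedDeriv_eq_iteratedFDeriv]
  have h3 : (fun t : ℝ => f (x + t • v)) =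
      (fun y => f (x + y)) ∘ ContinuousLinearMap.toSpanSingleton ℝ v := by
    ext t
    simp
  rw [h3, h2, ContinuousMultilinearMap.compContinuousLinearMap_apply,
    iteratedFDeriv_comp_add_left]
  simp

theorem fwdDiff_iter_comp_line (f : E → ℝ) (x v : E) (j : ℕ) (s : ℝ) :
    (fwdDiff s)^[j] (fun t : ℝ => f (x + t • v)) 0 = (fwdDiff (s • v))^[j] f x := by
  rw [fwdDiff_iter_eq_sum_shift, fwdDiff_iter_eq_sum_shift]
  simp only [zero_add, smul_assoc]

/-- A local bound on the `j`-th differences of a smooth function bounds its `j`-th derivative. -/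
theorem norm_iteratedFDeriv_le_of_fwdDiff {f : E → ℝ} (hf : ContDiff ℝ (⊤ : ℕ∞) f) {x : E}
    {j : ℕ} {C r : ℝ} (hC : 0 ≤ C) (hr : 0 < r)
    (h : ∀ v, ‖v‖ < r → |(fwdDiff v)^[j] f x| ≤ C * ‖v‖ ^ j) :
    ‖iteratedFDeriv ℝ j f x‖ ≤ 2 ^ j * (C * j ^ j) := by
  -- Restriction to the line through x in direction v reduces diagonal values to one variable. The
  -- one-sided estimate is used for f and for -f.
  have hdir : ∀ {g : E → ℝ}, ContDiff ℝ (⊤ : ℕ∞) g →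
      (∀ v, ‖v‖ < r → (fwdDiff v)^[j] g x ≤ C * ‖v‖ ^ j) →
      ∀ v, (iteratedFDeriv ℝ j g x fun _ => v) ≤ C * ‖v‖ ^ j := by
    intro g hg h v
    rw [← iteratedDeriv_comp_line hg]
    have hline : ContDiff ℝ (⊤ : ℕ∞) fun t : ℝ => g (x + t • v) :=
      hg.comp (contDiff_const.add (contDiff_id.smul contDiff_const))
    have hv : 0 < ‖v‖ + 1 := by positivity
    refine iteratedDeriv_le_of_fwdDiff_iter_le (r := r / (‖v‖ + 1))
      (hline.of_le (by exact_mod_cast le_top)) (by positivity) fun s hs hsr => ?_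
    rw [fwdDiff_iter_comp_line]
    rw [lt_div_iff₀ hv] at hsr
    refine (h (s • v) ?_).trans_eq ?_
    · rw [norm_smul, Real.norm_of_nonneg hs.le]
      nlinarith
    · rw [norm_smul, Real.norm_of_nonneg hs.le]
      ring
  have hneg : ∀ v, -(iteratedFDeriv ℝ j f x fun _ => v) ≤ C * ‖v‖ ^ j := by
    intro v
    have := hdir (g := -f) hf.neg (fun v hv => ?_) v
    · simpa [iteratedFDeriv_neg] using this
    · have h1 := fwdDiff_iter_const_smul v (-1 : ℝ) f j
      rw [neg_one_smul, neg_one_smul] at h1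
      rw [h1]
      exact (neg_le_abs _).trans (h v hv)
  refine ContinuousMultilinearMap.opNorm_le_of_diag _ (fun σ v => ?_) hC fun v => ?_
  · exact hf.iteratedFDeriv_comp_perm x σ v
  · exact abs_le'.2 ⟨hdir hf (fun v hv => (le_abs_self _).trans (h v hv)) v, hneg v⟩

variable [MeasurableSpace E] [BorelSpace E] [FiniteDimensional ℝ E] {μ : Measure E}

/-- Convolution commutes with translations. Integrability is carried along so that the next
convolution exists. -/
theorem fwdDiff_iter_convolution [μ.IsAddHaarMeasure] {φ : E → ℝ} (hφ : Continuous φ)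
    (hc : HasCompactSupport φ) (v : E) (j : ℕ) {g : E → ℝ} (hg : Integrable g μ) :
    (fwdDiff v)^[j] (φ ⋆[ContinuousLinearMap.lsmul ℝ ℝ, μ] g) =
      φ ⋆[ContinuousLinearMap.lsmul ℝ ℝ, μ] (fwdDiff v)^[j] g ∧
    Integrable ((fwdDiff v)^[j] g) μ := by
  induction j generalizing g with
  | zero => exact ⟨rfl, hg⟩
  | succ j ih =>
    have hv : Integrable (fun x => g (x + v)) μ := hg.comp_add_right v
    rw [Function.iterate_succ_apply, Function.iterate_succ_apply]
    have h1 : fwdDiff v (φ ⋆[ContinuousLinearMap.lsmul ℝ ℝ, μ] g) =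
        φ ⋆[ContinuousLinearMap.lsmul ℝ ℝ, μ] fwdDiff v g := by
      ext x
      have e1 := hc.convolutionExists_left (ContinuousLinearMap.lsmul ℝ ℝ) hφ
        hg.locallyIntegrable (x + v)
      have e2 := hc.convolutionExists_left (ContinuousLinearMap.lsmul ℝ ℝ) hφ
        hg.locallyIntegrable x
      simp only [fwdDiff, convolution_def]
      rw [← integral_sub e1 e2]
      refine integral_congr_ae (Filter.Eventually.of_forall fun t => ?_)
      simp only [ContinuousLinearMap.lsmul_apply, smul_eq_mul, mul_sub]
      rw [show x + v - t = x - t + v by abel]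
    rw [h1]
    exact ih (hv.sub hg)

end Mollification

/-! ### Regularity from bounds on differences -/

section BoundedDifferences

open MeasureTheory

open scoped Convolution

/-- A function whose differences of orders `1, …, k + 1` are of the order of the corresponding
power of the step is `C^{k,1}`. -/
theorem lipDiffAt_of_fwdDiff {m : ℕ} (k : ℕ) {f : (Fin m → ℝ) → ℝ} {a : Fin m → ℝ}
    (h : ∀ j ≤ k, ∃ C, ∃ r > 0, ∀ x v, ‖x - a‖ < r → ‖v‖ < r →
      |(fwdDiff v)^[j + 1] f x| ≤ C * ‖v‖ ^ (j + 1)) : LipDiffAt k f a := by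
  -- One δ serves all orders. The factor 16 leaves room for the nested balls of radii δ, 2δ, 4δ and
  -- 8δ below.
  have hev : ∀ᶠ δ : ℝ in 𝓝[>] 0, ∀ j ∈ Finset.range (k + 1), ∃ C, 0 ≤ C ∧
      ∀ x v, ‖x - a‖ < 16 * δ → ‖v‖ < 16 * δ →
        |(fwdDiff v)^[j + 1] f x| ≤ C * ‖v‖ ^ (j + 1) := by
    rw [Filter.eventually_all_finset]
    intro j hj
    obtain ⟨C, r, hr, hC⟩ := h j (Nat.le_of_lt_succ (Finset.mem_range.1 hj))
    filter_upwards [mem_nhdsWithin_of_mem_nhds (Iio_mem_nhds (show (0 : ℝ) < r / 16 by positivity))]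
      with δ hδ
    have hδ : 16 * δ < r := by
      have : δ < r / 16 := hδ
      linarith
    refine ⟨|C|, abs_nonneg C, fun x v hx hv => (hC x v (hx.trans hδ) (hv.trans hδ)).trans ?_⟩
    gcongr
    exact le_abs_self C
  obtain ⟨δ, hQ, hδ⟩ := (hev.and self_mem_nhdsWithin).exists
  have hδ : 0 < δ := hδ
  choose! C hC0 hC using hQ
  -- No regularity of f is assumed: the first differences already make it Lipschitz, hence
  -- integrable on a compact ball.
  have hlip : LipschitzOnWith (C 0).toNNReal f (Metric.ball a (8 * δ)) := by
    refine LipschitzOnWith.of_dist_le_mul fun y hy z hz => ?_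
    rw [Metric.mem_ball, dist_eq_norm] at hy hz
    have hyz : ‖y - z‖ < 16 * δ := by
      have := norm_sub_le (y - a) (z - a)
      rw [sub_sub_sub_cancel_right] at this
      linarith
    have := hC 0 (by simp) z (y - z) (by linarith) hyz
    simp only [zero_add, Function.iterate_one, fwdDiff, add_sub_cancel, pow_one] at this
    rw [dist_eq_norm, dist_eq_norm, Real.coe_toNNReal _ (hC0 0 (by simp))]
    exact this
  let K : Set (Fin m → ℝ) := Metric.closedBall a (4 * δ)
  have hKball : K ⊆ Metric.ball a (8 * δ) := Metric.closedBall_subset_ball (by linarith)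
  let g : (Fin m → ℝ) → ℝ := K.indicator f
  have hgint : Integrable g volume :=
    ((hlip.continuousOn.mono hKball).integrableOn_compact
      (isCompact_closedBall a (4 * δ))).integrable_indicator measurableSet_closedBall
  have hgf : ∀ y ∈ K, g y = f y := fun y hy => Set.indicator_of_mem hy f
  let φ : ℕ → ContDiffBump (0 : Fin m → ℝ) := fun n =>
    ⟨δ / (n + 2), δ / (n + 1), by positivity, by gcongr; linarith⟩
  have hφδ : ∀ n, (φ n).rOut ≤ δ := fun n =>
    div_le_self hδ.le (by linarith [(Nat.cast_nonneg n : (0 : ℝ) ≤ n)])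
  let F : ℕ → (Fin m → ℝ) → ℝ := fun n =>
    (φ n).normed volume ⋆[ContinuousLinearMap.lsmul ℝ ℝ, volume] g
  have hF : ∀ n, ContDiff ℝ (⊤ : ℕ∞) (F n) := fun n =>
    (φ n).hasCompactSupport_normed.contDiff_convolution_left _ (φ n).contDiff_normed
      hgint.locallyIntegrable
  have hFdiff : ∀ n, ∀ j ≤ k, ∀ x ∈ Metric.ball a δ, ∀ v : Fin m → ℝ, ‖v‖ < δ / (k + 1) →
      |(fwdDiff v)^[j + 1] (F n) x| ≤ C j * ‖v‖ ^ (j + 1) := by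
    intro n j hj x hx v hv
    have hjk : j ∈ Finset.range (k + 1) := Finset.mem_range.2 (Nat.lt_succ_of_le hj)
    obtain ⟨h1, h2⟩ := fwdDiff_iter_convolution ((φ n).contDiff_normed (μ := volume) (n := 0)).continuous
      (φ n).hasCompactSupport_normed v (j + 1) hgint
    have hkv : (k + 1) * ‖v‖ < δ := by
      rw [lt_div_iff₀ (by positivity)] at hv
      linarith
    have hvδ : ‖v‖ < 16 * δ := by
      have : ‖v‖ ≤ (k + 1) * ‖v‖ := le_mul_of_one_le_left (norm_nonneg v) (by
        linarith [(Nat.cast_nonneg k : (0 : ℝ) ≤ k)])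
      linarith
    rw [h1, ← Real.dist_0_eq_abs]
    -- The kernel is nonnegative with integral 1, so the difference of the mollified function
    -- averages differences of g at points within 2δ of a. All their sample points stay in K, where
    -- g = f, and the constant C j survives.
    refine dist_convolution_le (mul_nonneg (hC0 j hjk) (by positivity))
      (φ n).support_normed_eq.subset (φ n).nonneg_normed (φ n).integral_normed
      h2.aestronglyMeasurable fun y hy => ?_
    have hya : ‖y - a‖ < 2 * δ := by
      have h3 := dist_triangle y x a
      rw [Metric.mem_ball] at hx hy
      rw [← dist_eq_norm]
      linarith [hφδ n]
    have h4 : (fwdDiff v)^[j + 1] g y = (fwdDiff v)^[j + 1] f y := by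
      rw [fwdDiff_iter_eq_sum_shift, fwdDiff_iter_eq_sum_shift]
      refine Finset.sum_congr rfl fun i hi => ?_
      rw [hgf]
      rw [Metric.mem_closedBall, dist_eq_norm]
      have hi : (i : ℝ) ≤ k + 1 := by
        have : i ≤ k + 1 := (Nat.le_of_lt_succ (Finset.mem_range.1 hi)).trans (by omega)
        exact_mod_cast this
      calc ‖y + i • v - a‖ = ‖(y - a) + i • v‖ := by congr 1; abel
        _ ≤ ‖y - a‖ + i * ‖v‖ := (norm_add_le _ _).trans (by
            gcongr
            exact norm_nsmul_le)
        _ ≤ 4 * δ := by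
            have := mul_le_mul_of_nonneg_right hi (norm_nonneg v)
            linarith
    rw [Real.dist_0_eq_abs, h4]
    exact hC j hjk y v (by linarith) hvδ
  refine lipDiffAt_of_tendsto k (r := δ) hF (fun j hj => ?_) (fun x hx => ?_) a
    (Metric.mem_ball_self hδ)
  · exact ⟨_, fun n x hx => norm_iteratedFDeriv_le_of_fwdDiff (hF n)
      (hC0 j (Finset.mem_range.2 (Nat.lt_succ_of_le hj))) (by positivity) (hFdiff n j hj x hx)⟩
  · have hxK : x ∈ Metric.ball a (4 * δ) := Metric.ball_subset_ball (by linarith) hx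
    have hgx : ContinuousAt g x := by
      refine ((hlip.continuousOn.continuousAt (Metric.isOpen_ball.mem_nhds
        (hKball (Metric.ball_subset_closedBall hxK)))).congr ?_)
      filter_upwards [Metric.isOpen_ball.mem_nhds hxK] with y hy
      exact (hgf y (Metric.ball_subset_closedBall hy)).symm
    rw [← hgf x (Metric.ball_subset_closedBall hxK)]
    refine ContDiffBump.convolution_tendsto_right (φ := φ) (g := fun _ => g) (k := fun _ => x) ?_
      (Filter.Eventually.of_forall fun _ => hgint.aestronglyMeasurable)
      (hgx.tendsto.comp Filter.tendsto_snd) tendsto_const_nhds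
    exact tendsto_const_nhds.div_atTop
      (Filter.tendsto_atTop_add_const_right _ _ tendsto_natCast_atTop_atTop)

end BoundedDifferences

/-! ## Detection of `Lipᵏ` functions by smooth curves -/

section Detection

variable {E F : Type*} [NormedAddCommGroup E] [NormedSpace ℝ E] [NormedAddCommGroup F]
  [NormedSpace ℝ F]

theorem lipDiffAt_iff_forall_nat {k : ℕ∞} {f : E → F} {x : E} :
    LipDiffAt k f x ↔ ∀ n : ℕ, (n : ℕ∞) ≤ k → LipDiffAt n f x := by
  refine ⟨fun h n hn => ⟨h.1.of_le (by exact_mod_cast hn), fun j hj => h.2 j (hj.trans hn)⟩,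
    fun h => ⟨?_, fun j hj => (h j hj).2 j le_rfl⟩⟩
  induction k using ENat.recTopCoe with
  | top => exact contDiffAt_infty.2 fun n => (h n le_top).1
  | coe k => exact (h k le_rfl).1

theorem ContDiff.lipDiffAt {f : E → F} (hf : ContDiff ℝ (⊤ : ℕ∞) f) (k : ℕ∞) (x : E) :
    LipDiffAt k f x := by
  refine ⟨hf.contDiffAt.of_le (by exact_mod_cast le_top), fun j _ => ?_⟩
  exact ((hf.iteratedFDeriv_right (m := 1) (i := j)
    (by exact_mod_cast le_top)).contDiffAt (x := x)).exists_lipschitzOnWith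

theorem mem_lipLine_iff {k : ℕ∞} {f : ℝ → ℝ} : f ∈ lipLine k ↔ ∀ t, LipDiffAt k f t := by
  have h : ∀ j t, LipNear (iteratedFDeriv ℝ j f) t ↔ LipNear (iteratedDeriv j f) t := by
    intro j t
    rw [iteratedFDeriv_eq_equiv_comp]
    simp only [LipNear, LipschitzOnWith, Function.comp_apply, LinearIsometryEquiv.edist_map]
  simp only [lipLine, Set.mem_ofPred_eq, LipDiffAt, h, LocallyLipschitz, contDiff_iff_contDiffAt]
  exact ⟨fun H t => ⟨H.1 t, fun j hj => H.2 j hj t⟩,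
    fun H => ⟨fun t => (H t).1, fun j hj t => (H t).2 j hj⟩⟩

theorem lineMaps_lipClass (k : ℕ∞) : (lipClass k).lineMaps = lipLine k := by
  ext f
  rw [mem_lipLine_iff]
  let e : (Fin 1 → ℝ) → ℝ := fun x => x 0
  let e' : ℝ → (Fin 1 → ℝ) := fun t _ => t
  have he : ContDiff ℝ (⊤ : ℕ∞) e := contDiff_apply ℝ ℝ 0
  have he' : ContDiff ℝ (⊤ : ℕ∞) e' := contDiff_pi.2 fun _ => contDiff_id
  refine Iff.trans isLip_iff ⟨fun ⟨g, hg, hl⟩ t => ?_, fun hl => ⟨e' ∘ f ∘ e, fun _ => rfl, ?_⟩⟩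
  · have hfg : f = e ∘ g ∘ e' := by
      ext s
      exact (congrFun (hg ⟨e' s, trivial⟩) 0).symm
    rw [hfg]
    refine LipDiffAt.comp isOpen_univ (fun s _ => ?_) (fun s _ => he.lipDiffAt k _) trivial
    exact LipDiffAt.comp isOpen_univ (fun s _ => he'.lipDiffAt k s) (fun s _ => hl _ trivial)
      trivial
  · intro x _
    refine LipDiffAt.comp isOpen_univ (fun s _ => ?_) (fun s _ => he'.lipDiffAt k _) trivial
    exact LipDiffAt.comp isOpen_univ (fun s _ => he.lipDiffAt k s) (fun s _ => hl _) trivial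

/-- Functions in `Lipʲ` have differences of order `j + 1` bounded by the power of the step. -/
theorem exists_fwdDiff_bound_of_mem_lipLine {k : ℕ∞} {g : ℝ → ℝ} (hg : g ∈ lipLine k) {j : ℕ}
    (hj : (j : ℕ∞) ≤ k) :
    ∃ L, ∀ t ∈ Set.Icc (0 : ℝ) 1, ∀ s ∈ Set.Icc (0 : ℝ) 1,
      |(fwdDiff s)^[j + 1] g t| ≤ L * s ^ (j + 1) := by
  -- With t, s ≤ 1 all points u + s, u ≤ t + j s, lie in [0, j + 2].
  have hl : LocallyLipschitzOn (Set.Icc (0 : ℝ) (j + 2)) (iteratedDeriv j g) :=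
    (hg.2 j hj).locallyLipschitzOn
  obtain ⟨K, hK⟩ := hl.exists_lipschitzOnWith_of_compact isCompact_Icc
  refine ⟨K, fun t ht s hs => abs_fwdDiff_iter_le (hg.1.of_le (by exact_mod_cast hj)) hs.1
    fun u hu => ?_⟩
  have hjs : j * s ≤ j := mul_le_of_le_one_right (Nat.cast_nonneg j) hs.2
  have h1 := hK.dist_le_mul (u + s) ⟨by linarith [hu.1, ht.1, hs.1],
    by linarith [hu.2, ht.2, hs.2]⟩ u ⟨by linarith [hu.1, ht.1], by linarith [hu.2, ht.2]⟩
  rwa [Real.dist_eq, Real.dist_eq, add_sub_cancel_left, abs_of_nonneg hs.1] at h1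

/-- Boman's theorem for `Lipᵏ`: a function whose composites with smooth curves are `Lipᵏ` is
`Lipᵏ`. -/
theorem lipDiffAt_of_curves {k : ℕ∞} {m : ℕ} {U : Set (Fin m → ℝ)} (hU : IsOpen U)
    {h : (Fin m → ℝ) → ℝ}
    (hc : ∀ c : ℝ → (Fin m → ℝ), ContDiff ℝ (⊤ : ℕ∞) c → (∀ t, c t ∈ U) → h ∘ c ∈ lipLine k)
    {a : Fin m → ℝ} (ha : a ∈ U) : LipDiffAt k h a :=
  lipDiffAt_iff_forall_nat.2 fun n hn => lipDiffAt_of_fwdDiff n fun j hj =>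
    exists_fwdDiff_bound_of_curves hU (fun c hcs hcU =>
      exists_fwdDiff_bound_of_mem_lipLine (hc c hcs hcU)
        (le_trans (by exact_mod_cast hj) hn)) ha

/-- One direction is closure under composition. In the other, smooth curves are Lipᵏ, so Boman's
theorem applies to the extension of h by 0, whose values outside the open set U do not matter. -/
theorem lipClass_detectedByCurves (k : ℕ∞) : (lipClass k).DetectedByCurves := by
  classical
  intro m U h
  refine ⟨fun hh γ hγ => (lipClass k).comp ⊤ U (fun t => γ (t.1 0)) _ hγ hh, fun hh => ?_⟩
  let g : (Fin m → ℝ) → ℝ := fun x => if hx : x ∈ U then h ⟨x, hx⟩ else 0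
  have hg : ∀ x : U, g x = h x := fun x => dif_pos x.2
  have hgl : ∀ x ∈ U, LipDiffAt k g x := fun x hx => by
    refine lipDiffAt_of_curves U.isOpen (fun c hc hcU => ?_) hx
    have hcl : (lipClass k).mem ⊤ fun t : (⊤ : Opens (Fin 1 → ℝ)) => c (t.1 0) :=
      isLip_iff.2 ⟨fun t => c (t 0), fun _ => rfl, fun t _ =>
        (hc.comp (contDiff_apply ℝ ℝ 0)).lipDiffAt k t⟩
    have := hh (fun t => ⟨c t, hcU t⟩) hcl
    rw [lineMaps_lipClass] at this
    convert this using 1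
    ext t
    exact hg ⟨c t, hcU t⟩
  refine isLip_iff.2 ⟨fun x _ => g x, fun x => funext fun _ => hg x, fun x hx => ?_⟩
  have he' : ContDiff ℝ (⊤ : ℕ∞) fun (t : ℝ) (_ : Fin 1) => t := contDiff_pi.2 fun _ => contDiff_id
  exact LipDiffAt.comp U.isOpen hgl (fun y _ => he'.lipDiffAt k (g y)) hx

end Detection

theorem proposition5p2 (k : ℕ∞) :
    -- (a) the diffeology defined by an `M`-structure, and the functor `Ψ`
    ((∀ (X : Type u) (s : MStructure (lipLine k) X),
        (s.toDiffeology (lipClass k)).curves = s.curves ∧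
        (s.toDiffeology (lipClass k)).realMaps = s.functions) ∧
      Function.Injective (psi.{u} (lipClass k) (lipLine k)).obj ∧
      (psi.{u} (lipClass k) (lipLine k)).Full ∧
      (psi.{u} (lipClass k) (lipLine k)).Faithful) ∧
    -- (b) the `M`-structure generated by the `1`-plaques, and the functor `Υ`
    ((∀ (X : Type u) (P : Diffeology (lipClass k) X),
        (P.curves ⊆ (P.toMStructure (lipLine k)).curves ∧
          ∀ s : MStructure (lipLine k) X, P.curves ⊆ s.curves →
            (P.toMStructure (lipLine k)).curves ⊆ s.curves) ∧
        (P.toMStructure (lipLine k)).functions = P.realMaps) ∧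
      (upsilon.{u} (lipClass k) (lipLine k)).Faithful ∧
      Function.Surjective (upsilon.{u} (lipClass k) (lipLine k)).obj ∧
      psi.{u} (lipClass k) (lipLine k) ⋙ upsilon.{u} (lipClass k) (lipLine k) =
        𝟭 (MSpace.{u} (lipLine k)) ∧
      ∀ (X : Type u) (P : Diffeology (lipClass k) X),
        ((P.toMStructure (lipLine k)).toDiffeology (lipClass k)).Equivalent P) ∧
    -- (c) the equivalence induced by `Ψ`, for `Lipᵏ`
    ((∃ e : MSpace.{u} (lipLine k) ≌ PMOne.{u} (lipClass k),
        e.functor ⋙ (isMaximalSpace.{u} (lipClass k)).ι =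
          psi.{u} (lipClass k) (lipLine k) ⋙ toWeak.{u} (lipClass k)) ∧
      (psi.{u} (lipClass k) (lipLine k) ⋙ toWeak.{u} (lipClass k)).IsEquivalence) ∧
    -- (c) the same for every class that is detected by curves
    (∀ PM : ParamClass, PM.DetectedByCurves →
      (∃ e : MSpace.{u} PM.lineMaps ≌ PMOne.{u} PM,
        e.functor ⋙ (isMaximalSpace.{u} PM).ι =
          psi.{u} PM PM.lineMaps ⋙ toWeak.{u} PM) ∧
      (psi.{u} PM PM.lineMaps ⋙ toWeak.{u} PM).IsEquivalence) := by
  have hdet := lipClass_detectedByCurves k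
  rw [← lineMaps_lipClass k]
  exact ⟨⟨fun X s => ⟨s.curves_toDiffeology, s.realMaps_toDiffeology⟩, psi_obj_injective _,
      psi_full _, psi_faithful _ _⟩,
    ⟨fun X P => ⟨⟨P.curves_subset_toMStructure, P.toMStructure_curves_subset⟩,
      P.functions_toMStructure hdet⟩, upsilon_faithful _ _, upsilon_obj_surjective _,
      psi_comp_upsilon _, fun X P => P.realMaps_toDiffeology_toMStructure hdet⟩,
    ⟨exists_equivalence_PMOne hdet, psi_comp_toWeak_isEquivalence hdet⟩,
    fun PM hPM => ⟨exists_equivalence_PMOne hPM, psi_comp_toWeak_isEquivalence hPM⟩⟩
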